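/- For a graph $G$, a bond percolation model on $G$ is a probability distribution on the spanning subgraphs of $G$ (each edge being open, i.e. present, or closed). It is 1-independent if, for any two sets $S_1,S_2$ of edges of $G$ such that no edge of $S_1$ shares a vertex with an edge of $S_2$, the states of the edges in $S_1$ are independent of the states of the edges in $S_2$. It percolates if the random subgraph has an infinite component with positive probability. Let $\mathcal D_{\ge p}(G)$ be the class of 1-independent bond percolation models on $G$ in which each edge is open with probability at least $p$, and let $$p_{\max}(G)=\sup\{p\in[0,1] : \text{some model in } \mathcal D_{\ge p}(G) \text{ does not percolate}\}.$$ Let $Q_k$ be the $k$-dimensional hypercube graph, with vertex set $\{0,1\}^k$ and edges between vertices that differ in exactly one coordinate, and let $\mathbb Z^n$ be the $n$-dimensional integer lattice graph, with edges between vertices at Euclidean distance $1$. Theorem 1.4. Let $p\in(0,1]$, let $k\ge 1$ be an integer, and let $P>(1-p)^{2^{k-1}}\varphi$ be a real number, where $\varphi=\frac12(\sqrt5+1)$ is the golden ratio. Suppose that for every model in $\mathcal D_{\ge p}(Q_k)$ the probability that the random subgraph is connected is at least $P$. Then there is an $N$ such that for all $n\ge N$ every model in $\mathcal D_{\ge p}(\mathbb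 Z^n)$ percolates. In particular, the limit $\lim_{n\to\infty}p_{\max}(\mathbb Z^n)$ exists and $$\lim_{n\to\infty}p_{\max}(\mathbb Z^n)\le p.$$ -/

import Mathlib

open MeasureTheory ProbabilityTheory Filter Topology

namespace Percolation

/-- An edge configuration of `G`: each edge is open (`true`) or closed (`false`). It encodes a
spanning subgraph of `G`, and carries the product `σ`-algebra. -/
abbrev Config {V : Type*} (G : SimpleGraph V) : Type _ := G.edgeSet → Bool

/-- The spanning subgraph of `G` formed by the open edges of `ω`. -/
def openGraph {V : Type*} {G : SimpleGraph V} (ω : Config G) : SimpleGraph V where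
  Adj u v := ∃ h : G.Adj u v, ω ⟨s(u, v), h⟩ = true
  symm := ⟨by
    rintro u v ⟨h, hω⟩
    refine ⟨h.symm, ?_⟩
    have e : (⟨s(v, u), h.symm⟩ : G.edgeSet) = ⟨s(u, v), h⟩ := Subtype.ext Sym2.eq_swap
    rw [e]
    exact hω⟩
  loopless := ⟨fun u hu => G.loopless.irrefl u hu.1⟩

/-- Two sets of edges such that no edge of the first shares a vertex with an edge of the second. -/
def VertexDisjoint {V : Type*} {G : SimpleGraph V} (S₁ S₂ : Set G.edgeSet) : Prop :=
  ∀ e ∈ S₁, ∀ f ∈ S₂, ∀ v : V, v ∈ (e : Sym2 V) → v ∉ (f : Sym2 V)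

/-- 1-independence: the states of the edges of `S₁` are independent of the states of the edges
of `S₂` whenever `S₁` and `S₂` are vertex-disjoint sets of edges. -/
def OneIndependent {V : Type*} (G : SimpleGraph V) (μ : Measure (Config G)) : Prop :=
  ∀ S₁ S₂ : Set G.edgeSet, VertexDisjoint S₁ S₂ →
    IndepFun (fun (ω : Config G) (e : S₁) => ω e) (fun (ω : Config G) (e : S₂) => ω e) μ

/-- The class `𝒟_{≥p}(G)` of 1-independent bond percolation models on `G` in which each edge is
open with probability at least `p`. -/
def DGe {V : Type*} (G : SimpleGraph V) (p : ℝ) : Set (Measure (Config G)) :=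
  {μ | IsProbabilityMeasure μ ∧ OneIndependent G μ ∧
    ∀ e : G.edgeSet, p ≤ μ.real {ω | ω e = true}}

/-- The open subgraph has an infinite component with positive probability. -/
def Percolates {V : Type*} {G : SimpleGraph V} (μ : Measure (Config G)) : Prop :=
  0 < μ {ω | ∃ C : (openGraph ω).ConnectedComponent, C.supp.Infinite}

/-- The supremum of those probabilities `p` for which some model in `𝒟_{≥p}(G)` does not
percolate. -/
noncomputable def pMax {V : Type*} (G : SimpleGraph V) : ℝ :=
  sSup {p : ℝ | p ∈ Set.Icc 0 1 ∧ ∃ μ ∈ DGe G p, ¬ Percolates μ}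

/-- The hypercube graph `Q_n`: vertices of `{0,1}^n` are adjacent iff they differ in exactly one
coordinate. -/
def cube (n : ℕ) : SimpleGraph (Fin n → Bool) where
  Adj x y := ∃! i, x i ≠ y i
  symm := ⟨fun x y h => by simpa only [ne_comm] using h⟩
  loopless := ⟨fun x h => by obtain ⟨i, hi, -⟩ := h; exact hi rfl⟩

/-- The lattice graph `ℤ^n`: vertices are adjacent iff they differ by exactly `1` in one
coordinate and agree in all the others. -/
def lattice (n : ℕ) : SimpleGraph (Fin n → ℤ) where
  Adj x y := ∃ i, |x i - y i| = 1 ∧ ∀ j, j ≠ i → x j = y j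
  symm := ⟨fun x y ⟨i, hi, h⟩ => ⟨i, by rw [abs_sub_comm]; exact hi, fun j hj => (h j hj).symm⟩⟩
  loopless := ⟨fun x ⟨i, hi, _⟩ => by simp at hi⟩

end Percolation

/-! The proof makes cubes reliable, routes reliably between them, then renormalises a planar model.

Cubes. Two facets of `Q_{k+1}` that are both connected are joined by `2^k` disjoint edges, so a
bound `P` for `Q_k` gives `P² - (1-p)^{2^k}` for `Q_{k+1}`. For `p < 1` and `x = P /
(1-p)^{2^{k-1}}` this is the map `x ↦ x² - 1`, whose repelling fixed point is the golden ratio.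
Starting above it, `x` tends to infinity, so (`exists_conn_ratio`) in large cubes `(1-p)^{2^k} / P²`
is as small as desired. This ratio bounds the conditional probability that two adjacent blocks are
separated, given that both are connected. The bound survives conditioning on which other blocks are
connected, so a route may be chosen after seeing the connected blocks, at the cost of its own edges
only (`measure_selected_sep_le`).

Coarse model. For large `n` the lattice contains the plane times two stars times a cube. Over each
planar point the leaves of one star are candidate hubs, and the first connected one is the hub; the
leaves of the other star give many disjoint routes between hubs of neighbouring points. Hence coarse
edges are very likely open (`measure_compl_coarseOpen_le`). A hub depends only on the cell of its
own point, so open coarse edges chain together and the coarse model is again 1-independent.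

Plane. Grouping points into `2 × 2` blocks squares the failure probability up to a constant
(`IsCoarse.renorm`), while colours by open component pass to a majority colour
(`Compatible.renorm`). With positive probability the three edges used near the origin are open at
all scales, which forces one component to meet infinitely many disjoint cells
(`IsCoarse.percolates`).

The limit exists because `pMax` of the lattice is nonincreasing in the dimension and bounded below.
-/

namespace Percolation

/-! ### Events determined by finite vertex sets, and their independence -/

section Determined

variable {V : Type*} {G : SimpleGraph V}

/-- The event `A` depends only on the states of the edges with both endpoints in `R`. -/
def DeterminedBy (R : Set V) (A : Set (Config G)) : Prop :=
  ∀ ω ω' : Config G, (∀ e : G.edgeSet, (∀ v ∈ (e : Sym2 V), v ∈ R) → ω e = ω' e) →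
    ω ∈ A → ω' ∈ A

namespace DeterminedBy

variable {R R' : Set V} {A B : Set (Config G)}

lemma mono (h : DeterminedBy R A) (hR : R ⊆ R') : DeterminedBy R' A :=
  fun ω ω' hω => h ω ω' fun e he => hω e fun v hv => hR (he v hv)

lemma compl (h : DeterminedBy R A) : DeterminedBy R Aᶜ :=
  fun ω ω' hω hA hA' => hA (h ω' ω (fun e he => (hω e he).symm) hA')

lemma inter (h : DeterminedBy R A) (h' : DeterminedBy R B) : DeterminedBy R (A ∩ B) :=
  fun ω ω' hω hA => ⟨h ω ω' hω hA.1, h' ω ω' hω hA.2⟩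

lemma iInter {ι : Sort*} {A : ι → Set (Config G)} (h : ∀ i, DeterminedBy R (A i)) :
    DeterminedBy R (⋂ i, A i) :=
  fun ω ω' hω hA => Set.mem_iInter.2 fun i => h i ω ω' hω (Set.mem_iInter.1 hA i)

lemma iUnion {ι : Sort*} {A : ι → Set (Config G)} (h : ∀ i, DeterminedBy R (A i)) :
    DeterminedBy R (⋃ i, A i) := by
  intro ω ω' hω hA
  obtain ⟨i, hi⟩ := Set.mem_iUnion.1 hA
  exact Set.mem_iUnion.2 ⟨i, h i ω ω' hω hi⟩

/-- A finite vertex set spans finitely many edges, and every set of configurations on finitely many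
edges is measurable. Measurability of local events is therefore automatic. -/
lemma exists_preimage (hR : R.Finite) (h : DeterminedBy R A) :
    ∃ B : Set ({e : G.edgeSet | ∀ v ∈ (e : Sym2 V), v ∈ R} → Bool), MeasurableSet B ∧
      A = (fun (ω : Config G) (e : {e : G.edgeSet | ∀ v ∈ (e : Sym2 V), v ∈ R}) => ω e) ⁻¹' B := by
  have hfin : Finite {e : G.edgeSet | ∀ v ∈ (e : Sym2 V), v ∈ R} := by
    have h1 : ((fun x : V × V => s(x.1, x.2)) '' (R ×ˢ R)).Finite := (hR.prod hR).image _
    refine Set.Finite.to_subtype ?_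
    refine Set.Finite.of_finite_image (f := Subtype.val) (h1.subset ?_)
      Subtype.val_injective.injOn
    rintro _ ⟨⟨e, he'⟩, he, rfl⟩
    induction e using Sym2.ind with
    | _ u v => exact ⟨(u, v), ⟨he u (by simp), he v (by simp)⟩, rfl⟩
  refine ⟨(fun (ω : Config G) (e : {e : G.edgeSet | ∀ v ∈ (e : Sym2 V), v ∈ R}) => ω e) '' A,
    (Set.toFinite _).measurableSet, ?_⟩
  refine Set.Subset.antisymm (Set.subset_preimage_image _ _) ?_
  rintro ω ⟨ω', hA, hω⟩
  exact h ω' ω (fun e he => congrFun hω ⟨e, he⟩) hA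

lemma measurableSet (hR : R.Finite) (h : DeterminedBy R A) : MeasurableSet A := by
  obtain ⟨B, hB, rfl⟩ := h.exists_preimage hR
  exact (measurable_pi_lambda _ fun e => measurable_pi_apply _) hB

end DeterminedBy

variable {μ : Measure (Config G)}

/-- Edges spanned by disjoint vertex sets share no vertex. Later independence claims reduce to this
form, with vertex sets in place of edge sets. -/
lemma OneIndependent.measure_inter (hμ : OneIndependent G μ) {R R' : Set V}
    {A B : Set (Config G)} (hR : R.Finite) (hR' : R'.Finite) (hd : Disjoint R R')
    (hA : DeterminedBy R A) (hB : DeterminedBy R' B) :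
    μ.real (A ∩ B) = μ.real A * μ.real B := by
  obtain ⟨A', hA', rfl⟩ := hA.exists_preimage hR
  obtain ⟨B', hB', rfl⟩ := hB.exists_preimage hR'
  have := (hμ {e : G.edgeSet | ∀ v ∈ (e : Sym2 V), v ∈ R}
    {e : G.edgeSet | ∀ v ∈ (e : Sym2 V), v ∈ R'} (fun e he f hf v hv hv' =>
      Set.disjoint_left.1 hd (he v hv) (hf v hv'))).measure_inter_preimage_eq_mul A' B' hA' hB'
  simp only [Measure.real, this, ENNReal.toReal_mul]

lemma OneIndependent.measure_biInter [IsProbabilityMeasure μ] (hμ : OneIndependent G μ)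
    {ι : Type*} (T : Finset ι) {R : ι → Set V} {A : ι → Set (Config G)}
    (hR : ∀ i ∈ T, (R i).Finite) (hd : (T : Set ι).PairwiseDisjoint R)
    (hA : ∀ i ∈ T, DeterminedBy (R i) (A i)) :
    μ.real (⋂ i ∈ T, A i) = ∏ i ∈ T, μ.real (A i) := by
  classical
  induction T using Finset.induction_on with
  | empty => simp
  | insert a T ha ih =>
    rw [Finset.prod_insert ha, Finset.set_biInter_insert, ← ih
      (fun i hi => hR i (Finset.mem_insert_of_mem hi))
      (hd.subset (by simp))
      (fun i hi => hA i (Finset.mem_insert_of_mem hi))]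
    refine hμ.measure_inter (R' := ⋃ i ∈ T, R i) (hR a (Finset.mem_insert_self _ _))
      (T.finite_toSet.biUnion fun i hi => hR i (Finset.mem_insert_of_mem hi)) ?_
      (hA a (Finset.mem_insert_self _ _)) ?_
    · rw [Set.disjoint_iUnion₂_right]
      intro i hi
      exact hd (by simp) (by simp [hi]) (by rintro rfl; exact ha hi)
    · refine DeterminedBy.iInter fun i => DeterminedBy.iInter fun hi => ?_
      exact (hA i (Finset.mem_insert_of_mem hi)).mono (Set.subset_biUnion_of_mem (u := R) hi)

lemma determinedBy_edge (e : G.edgeSet) (b : Bool) :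
    DeterminedBy {v | v ∈ (e : Sym2 V)} {ω : Config G | ω e = b} :=
  fun _ _ hω hA => (hω e fun _ hv => hv).symm.trans hA

lemma finite_mem_sym2 (e : Sym2 V) : {v | v ∈ e}.Finite := by
  induction e using Sym2.ind with
  | _ u v =>
    refine (Set.toFinite {u, v}).subset fun w hw => ?_
    simpa using hw

lemma measure_closed_le {p : ℝ} (hμ : μ ∈ DGe G p) (e : G.edgeSet) :
    μ.real {ω | ω e = false} ≤ 1 - p := by
  have := hμ.1
  have h1 : {ω : Config G | ω e = false} = {ω | ω e = true}ᶜ := by ext; simp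
  rw [h1, probReal_compl_eq_one_sub
    ((determinedBy_edge e true).measurableSet (finite_mem_sym2 e.1))]
  linarith [hμ.2.2 e]

/-- A finite family of pairwise vertex-disjoint edges is entirely closed with probability at most
`(1 - p) ^ #T`. -/
lemma measure_all_closed_le {p : ℝ} (hμ : μ ∈ DGe G p) {ι : Type*} (T : Finset ι)
    (e : ι → G.edgeSet)
    (hd : ∀ i ∈ T, ∀ j ∈ T, i ≠ j → ∀ v, v ∈ (e i : Sym2 V) → v ∉ (e j : Sym2 V)) :
    μ.real (⋂ i ∈ T, {ω | ω (e i) = false}) ≤ (1 - p) ^ T.card := by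
  have := hμ.1
  rw [hμ.2.1.measure_biInter T (R := fun i => {v | v ∈ (e i : Sym2 V)})
    (fun i _ => finite_mem_sym2 _)
    (fun i hi j hj hij => Set.disjoint_left.2 fun v hv hv' => hd i hi j hj hij v hv hv')
    (fun i _ => determinedBy_edge _ _), ← Finset.prod_const]
  exact Finset.prod_le_prod (fun _ _ => measureReal_nonneg) fun i _ => measure_closed_le hμ _

end Determined

/-! ### Restricting a model along an injective graph homomorphism -/

section Pullback

variable {V W : Type*} {G : SimpleGraph V} {H : SimpleGraph W}

/-- The configuration on `G` induced by a configuration on `H` along a homomorphism. -/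
def pull (φ : G →g H) (ω : Config H) : Config G :=
  fun e => ω ⟨Sym2.map φ e, φ.map_mem_edgeSet e.2⟩

lemma measurable_pull (φ : G →g H) : Measurable (pull φ) :=
  measurable_pi_lambda _ fun _ => measurable_pi_apply _

lemma openGraph_adj {ω : Config G} {u v : V} (h : G.Adj u v) :
    (openGraph ω).Adj u v ↔ ω ⟨s(u, v), h⟩ = true :=
  ⟨fun ⟨_, h'⟩ => h', fun h' => ⟨h, h'⟩⟩

/-- A homomorphism maps the open subgraph of the induced configuration into the open subgraph. -/
def openHom (φ : G →g H) (ω : Config H) : openGraph (pull φ ω) →g openGraph ω where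
  toFun := φ
  map_rel' := fun ⟨h, h'⟩ => ⟨φ.map_adj h, h'⟩

lemma reachable_of_pull (φ : G →g H) {ω : Config H} {u v : V}
    (h : (openGraph (pull φ ω)).Reachable u v) : (openGraph ω).Reachable (φ u) (φ v) :=
  h.map (openHom φ ω)

lemma determinedBy_pull (φ : G →g H) (A : Set (Config G)) :
    DeterminedBy (Set.range φ) (pull φ ⁻¹' A) := by
  intro ω ω' h hA
  have : pull φ ω = pull φ ω' := by
    funext e
    refine h _ fun v hv => ?_
    obtain ⟨w, -, rfl⟩ := Sym2.mem_map.1 hv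
    exact ⟨w, rfl⟩
  rwa [Set.mem_preimage, ← this]

/-- Injectivity keeps the images of vertex-disjoint edge sets vertex-disjoint. This serves both for
subcubes inside a graph and for a lattice inside a larger one. -/
lemma DGe_map_pull {p : ℝ} {μ : Measure (Config H)} (hμ : μ ∈ DGe H p) (φ : G →g H)
    (hφ : Function.Injective φ) : μ.map (pull φ) ∈ DGe G p := by
  have := hμ.1
  have hm := measurable_pull φ
  refine ⟨Measure.isProbabilityMeasure_map hm.aemeasurable, ?_, ?_⟩
  · intro S₁ S₂ hS
    set F : G.edgeSet → H.edgeSet := fun e => ⟨Sym2.map φ e, φ.map_mem_edgeSet e.2⟩ with hF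
    have hdis : VertexDisjoint (F '' S₁) (F '' S₂) := by
      rintro _ ⟨e, he, rfl⟩ _ ⟨f, hf, rfl⟩ v hv hv'
      obtain ⟨w, hw, rfl⟩ := Sym2.mem_map.1 hv
      obtain ⟨w', hw', h⟩ := Sym2.mem_map.1 hv'
      rw [hφ h] at hw'
      exact hS e he f hf w hw hw'
    have hi := hμ.2.1 _ _ hdis
    have hi' := hi.comp
      (φ := fun (g : (F '' S₁) → Bool) (e : S₁) => g ⟨F e, Set.mem_image_of_mem F e.2⟩)
      (ψ := fun (g : (F '' S₂) → Bool) (e : S₂) => g ⟨F e, Set.mem_image_of_mem F e.2⟩)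
      (measurable_pi_lambda _ fun _ => measurable_pi_apply _)
      (measurable_pi_lambda _ fun _ => measurable_pi_apply _)
    have hm₁ : Measurable (fun (ω : Config G) (e : S₁) => ω e) :=
      measurable_pi_lambda _ fun _ => measurable_pi_apply _
    have hm₂ : Measurable (fun (ω : Config G) (e : S₂) => ω e) :=
      measurable_pi_lambda _ fun _ => measurable_pi_apply _
    rw [indepFun_iff_measure_inter_preimage_eq_mul]
    intro s t hs ht
    rw [Measure.map_apply hm ((hm₁ hs).inter (hm₂ ht)), Measure.map_apply hm (hm₁ hs),
      Measure.map_apply hm (hm₂ ht)]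
    exact hi'.measure_inter_preimage_eq_mul s t hs ht
  · intro e
    rw [map_measureReal_apply hm
      ((determinedBy_edge e true).measurableSet (finite_mem_sym2 e.1))]
    exact hμ.2.2 _

lemma measurableSet_adj (u v : V) : MeasurableSet {ω : Config G | (openGraph ω).Adj u v} := by
  by_cases h : G.Adj u v
  · simp only [openGraph_adj h]
    exact (determinedBy_edge ⟨s(u, v), h⟩ true).measurableSet (finite_mem_sym2 _)
  · have : {ω : Config G | (openGraph ω).Adj u v} = ∅ := by
      ext ω
      simp only [Set.mem_ofPred_eq, Set.mem_empty_iff_false, iff_false]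
      exact fun h' => h h'.1
    rw [this]
    exact MeasurableSet.empty

lemma measurableSet_exists_walk [Countable V] (n : ℕ) (u v : V) :
    MeasurableSet {ω : Config G | ∃ w : (openGraph ω).Walk u v, w.length = n} := by
  induction n generalizing u with
  | zero =>
    have : {ω : Config G | ∃ w : (openGraph ω).Walk u v, w.length = 0} = {_ω | u = v} := by
      ext ω
      simp only [Set.mem_ofPred_eq]
      constructor
      · rintro ⟨w, hw⟩
        exact SimpleGraph.Walk.eq_of_length_eq_zero hw
      · rintro rfl
        exact ⟨SimpleGraph.Walk.nil, rfl⟩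
    rw [this]
    exact MeasurableSet.const _
  | succ n ih =>
    have : {ω : Config G | ∃ w : (openGraph ω).Walk u v, w.length = n + 1} =
        ⋃ x, {ω | (openGraph ω).Adj u x} ∩
          {ω | ∃ w : (openGraph ω).Walk x v, w.length = n} := by
      ext ω
      simp only [Set.mem_ofPred_eq, Set.mem_iUnion, Set.mem_inter_iff]
      constructor
      · rintro ⟨w, hw⟩
        cases w with
        | nil => simp at hw
        | cons h w => exact ⟨_, h, w, by simpa using hw⟩
      · rintro ⟨x, h, w, hw⟩
        exact ⟨SimpleGraph.Walk.cons h w, by simp [hw]⟩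
    rw [this]
    exact MeasurableSet.iUnion fun x => (measurableSet_adj u x).inter (ih x)

lemma measurableSet_reachable [Countable V] (u v : V) :
    MeasurableSet {ω : Config G | (openGraph ω).Reachable u v} := by
  have : {ω : Config G | (openGraph ω).Reachable u v} =
      ⋃ n : ℕ, {ω | ∃ w : (openGraph ω).Walk u v, w.length = n} := by
    ext ω
    simp only [Set.mem_ofPred_eq, Set.mem_iUnion]
    exact ⟨fun ⟨w⟩ => ⟨_, w, rfl⟩, fun ⟨_, w, _⟩ => ⟨w⟩⟩
  rw [this]
  exact MeasurableSet.iUnion fun n => measurableSet_exists_walk n u v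

/-- Needed to evaluate a pushforward measure on the percolation event. An infinite component is one
that leaves every finite set, and on a countable vertex set this is a countable combination of
reachability events. -/
lemma measurableSet_infinite_component [Countable V] :
    MeasurableSet {ω : Config G |
      ∃ C : (openGraph ω).ConnectedComponent, C.supp.Infinite} := by
  have : {ω : Config G | ∃ C : (openGraph ω).ConnectedComponent, C.supp.Infinite} =
      ⋃ u : V, ⋂ F : Finset V, ⋃ v : V, {ω | (openGraph ω).Reachable v u} ∩ {_ω | v ∉ F} := by
    ext ω
    simp only [Set.mem_ofPred_eq, Set.mem_iUnion, Set.mem_iInter, Set.mem_inter_iff]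
    constructor
    · rintro ⟨C, hC⟩
      induction C using SimpleGraph.ConnectedComponent.ind with
      | _ u =>
        refine ⟨u, fun F => ?_⟩
        obtain ⟨v, hv, hF⟩ := hC.exists_notMem_finset F
        exact ⟨v, SimpleGraph.ConnectedComponent.exact hv, hF⟩
    · rintro ⟨u, hu⟩
      refine ⟨(openGraph ω).connectedComponentMk u, fun hfin => ?_⟩
      obtain ⟨v, hv, hF⟩ := hu hfin.toFinset
      exact hF (by simpa using hv)
  rw [this]
  exact MeasurableSet.iUnion fun u => MeasurableSet.iInter fun F => MeasurableSet.iUnion fun v =>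
    (measurableSet_reachable v u).inter (MeasurableSet.const _)

lemma Percolates.of_map_pull [Countable V] {μ : Measure (Config H)} (φ : G →g H)
    (hφ : Function.Injective φ) (h : Percolates (μ.map (pull φ))) : Percolates μ := by
  unfold Percolates at h ⊢
  rw [Measure.map_apply (measurable_pull φ) measurableSet_infinite_component] at h
  refine h.trans_le (measure_mono ?_)
  rintro ω ⟨C, hC⟩
  refine ⟨C.map (openHom φ ω), (hC.image hφ.injOn).mono ?_⟩
  rintro _ ⟨v, hv, rfl⟩
  rw [SimpleGraph.ConnectedComponent.mem_supp_iff] at hv ⊢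
  rw [← hv]
  rfl

end Pullback

/-! ### Monotonicity of the threshold in the dimension -/

section Lattice

lemma lattice_adj_extend {ι : Type*} {n : ℕ} (j : ι ↪ Fin n) {f g : ι → ℤ} (i : ι)
    (hi : |f i - g i| = 1) (h : ∀ i', i' ≠ i → f i' = g i') :
    (lattice n).Adj (Function.extend j f 0) (Function.extend j g 0) := by
  refine ⟨j i, ?_, fun a ha => ?_⟩
  · rwa [j.injective.extend_apply, j.injective.extend_apply]
  · by_cases h' : ∃ i', j i' = a
    · obtain ⟨i', rfl⟩ := h'
      rw [j.injective.extend_apply, j.injective.extend_apply]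
      exact h i' fun h'' => ha (h'' ▸ rfl)
    · rw [Function.extend_apply' _ _ _ h', Function.extend_apply' _ _ _ h']

/-- The inclusion of a lattice into a higher-dimensional one. -/
noncomputable def latticeHom {m n : ℕ} (h : m ≤ n) : lattice m →g lattice n where
  toFun := fun f => Function.extend (Fin.castLEEmb h) f 0
  map_rel' := fun {_ _} ⟨i, hi, h'⟩ => lattice_adj_extend (Fin.castLEEmb h) i hi h'

lemma latticeHom_injective {m n : ℕ} (h : m ≤ n) : Function.Injective (latticeHom h) :=
  Function.extend_injective (Fin.castLEEmb h).injective 0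

lemma DGe_anti {V : Type*} {G : SimpleGraph V} {p p' : ℝ} (h : p ≤ p') :
    DGe G p' ⊆ DGe G p := fun _ hμ => ⟨hμ.1, hμ.2.1, fun e => h.trans (hμ.2.2 e)⟩

lemma pMax_nonneg {V : Type*} (G : SimpleGraph V) : 0 ≤ pMax G :=
  Real.sSup_nonneg fun _ hx => hx.1.1

lemma pMax_le {V : Type*} {G : SimpleGraph V} {p : ℝ} (hp : 0 ≤ p)
    (h : ∀ μ ∈ DGe G p, Percolates μ) : pMax G ≤ p := by
  refine Real.sSup_le ?_ hp
  rintro x ⟨-, μ, hμ, hn⟩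
  by_contra! hx
  exact hn (h μ (DGe_anti hx.le hμ))

/-- A non-percolating model in the higher dimension restricts to a non-percolating one in the lower
dimension. -/
lemma pMax_lattice_antitone : Antitone fun n : ℕ => pMax (lattice n) := by
  intro m n hmn
  refine Real.sSup_le ?_ (pMax_nonneg _)
  rintro x ⟨hx, μ, hμ, hn⟩
  refine le_csSup ⟨1, fun y hy => hy.1.2⟩ ⟨hx, _, DGe_map_pull hμ (latticeHom hmn)
    (latticeHom_injective hmn), fun h => hn (h.of_map_pull _ (latticeHom_injective hmn))⟩

end Lattice

/-! ### Connected and separated copies of a cube -/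

section Blocks

variable {V : Type*} {G : SimpleGraph V} {k : ℕ}

/-- The copy `f` of the cube is connected by its open edges. -/
def blockConn (f : cube k →g G) : Set (Config G) :=
  {ω | (openGraph (pull f ω)).Connected}

/-- No edge between corresponding vertices of the two copies of the cube is open. -/
def blockSep (f g : cube k →g G) : Set (Config G) :=
  {ω | ∀ c, ¬ (openGraph ω).Adj (f c) (g c)}

lemma determinedBy_blockConn (f : cube k →g G) : DeterminedBy (Set.range f) (blockConn f) :=
  determinedBy_pull f {ω | (openGraph ω).Connected}

lemma determinedBy_blockSep (f g : cube k →g G) :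
    DeterminedBy (Set.range f ∪ Set.range g) (blockSep f g) := by
  intro ω ω' h hA c hc
  refine hA c ⟨hc.1, ?_⟩
  rw [h _ ?_]
  · exact hc.2
  · intro v hv
    rcases Sym2.mem_iff.1 hv with rfl | rfl
    · exact Or.inl ⟨c, rfl⟩
    · exact Or.inr ⟨c, rfl⟩

lemma blockConn.reachable {f : cube k →g G} {ω : Config G} (h : ω ∈ blockConn f)
    (c c' : Fin k → Bool) : (openGraph ω).Reachable (f c) (f c') :=
  reachable_of_pull f (h.preconnected c c')

lemma reachable_of_blocks {f g : cube k →g G} {ω : Config G} (hf : ω ∈ blockConn f)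
    (hg : ω ∈ blockConn g) (hs : ω ∉ blockSep f g) (c c' : Fin k → Bool) :
    (openGraph ω).Reachable (f c) (g c') := by
  have : ∃ d, (openGraph ω).Adj (f d) (g d) := by
    by_contra! h
    exact hs h
  obtain ⟨d, hd⟩ := this
  exact ((blockConn.reachable hf c d).trans hd.reachable).trans (blockConn.reachable hg d c')

variable {p P : ℝ} {μ : Measure (Config G)}

lemma le_measure_blockConn
    (hconn : ∀ μ ∈ DGe (cube k) p, P ≤ μ.real {ω | (openGraph ω).Connected})
    (hμ : μ ∈ DGe G p) (f : cube k →g G) (hf : Function.Injective f) :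
    P ≤ μ.real (blockConn f) := by
  have h := hconn _ (DGe_map_pull hμ f hf)
  have hdet : DeterminedBy Set.univ {ω : Config (cube k) | (openGraph ω).Connected} :=
    fun ω ω' hω hA => (funext fun e => hω e fun v _ => Set.mem_univ v : ω = ω') ▸ hA
  rwa [map_measureReal_apply (measurable_pull f) (hdet.measurableSet Set.finite_univ)] at h

lemma measure_blockSep_le (hμ : μ ∈ DGe G p) (f g : cube k →g G) (hf : Function.Injective f)
    (hg : Function.Injective g) (hd : Disjoint (Set.range f) (Set.range g))
    (hadj : ∀ c, G.Adj (f c) (g c)) : μ.real (blockSep f g) ≤ (1 - p) ^ 2 ^ k := by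
  have := hμ.1
  have h := measure_all_closed_le hμ (Finset.univ : Finset (Fin k → Bool))
    (fun c => ⟨s(f c, g c), hadj c⟩) ?_
  · have hc : (Finset.univ : Finset (Fin k → Bool)).card = 2 ^ k := by simp
    rw [hc] at h
    refine le_trans (measureReal_mono ?_) h
    intro ω hω
    simp only [Set.mem_iInter]
    intro c _
    have h' := hω c
    rw [openGraph_adj (hadj c)] at h'
    simpa using h'
  · intro c _ d _ hcd v hv hv'
    rcases Sym2.mem_iff.1 hv with rfl | rfl <;> rcases Sym2.mem_iff.1 hv' with h | h
    · exact hcd (hf h)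
    · exact Set.disjoint_left.1 hd ⟨c, rfl⟩ ⟨d, h.symm⟩
    · exact Set.disjoint_left.1 hd ⟨d, h.symm⟩ ⟨c, rfl⟩
    · exact hcd (hg h)

end Blocks

/-! ### Doubling the cube and the golden ratio -/

section Doubling

/-- The two facets of a cube orthogonal to the first direction. -/
def facet (k : ℕ) (b : Bool) : cube k →g cube (k + 1) where
  toFun := fun c => Fin.cons b c
  map_rel' := by
    rintro c d ⟨i, hi, h⟩
    refine ⟨i.succ, by simpa using hi, fun j hj => ?_⟩
    induction j using Fin.cases with
    | zero => simp at hj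
    | succ j => rw [h j (by simpa using hj)]

lemma facet_apply (k : ℕ) (b : Bool) (c : Fin k → Bool) :
    facet k b c = (Fin.cons b c : Fin (k + 1) → Bool) := rfl

lemma facet_injective (k : ℕ) (b : Bool) : Function.Injective (facet k b) :=
  Fin.cons_right_injective (α := fun _ => Bool) b

lemma facet_disjoint (k : ℕ) :
    Disjoint (Set.range (facet k false)) (Set.range (facet k true)) := by
  rw [Set.disjoint_left]
  rintro _ ⟨c, rfl⟩ ⟨d, hd⟩
  have := congrFun hd 0
  simp [facet_apply] at this

lemma facet_adj (k : ℕ) (c : Fin k → Bool) :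
    (cube (k + 1)).Adj (facet k false c) (facet k true c) := by
  refine ⟨0, by simp [facet_apply], fun j hj => ?_⟩
  induction j using Fin.cases with
  | zero => rfl
  | succ j => simp [facet_apply] at hj

lemma conn_of_facets {k : ℕ} {ω : Config (cube (k + 1))} (h₀ : ω ∈ blockConn (facet k false))
    (h₁ : ω ∈ blockConn (facet k true)) (hs : ω ∉ blockSep (facet k false) (facet k true)) :
    (openGraph ω).Connected := by
  have key : ∀ b b' c c', (openGraph ω).Reachable (facet k b c) (facet k b' c') := by
    rintro (_ | _) (_ | _) c c'
    · exact blockConn.reachable h₀ c c'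
    · exact reachable_of_blocks h₀ h₁ hs c c'
    · exact (reachable_of_blocks h₀ h₁ hs c' c).symm
    · exact blockConn.reachable h₁ c c'
  have : Nonempty (Fin (k + 1) → Bool) := ⟨fun _ => false⟩
  refine ⟨fun x y => ?_⟩
  have := key (x 0) (y 0) (Fin.tail x) (Fin.tail y)
  rwa [facet_apply, facet_apply, Fin.cons_self_tail, Fin.cons_self_tail] at this

/-- If `Q_k` is connected with probability at least `P`, then `Q_{k+1}` is connected with
probability at least `P² - (1-p)^{2^k}`. -/
lemma conn_succ {k : ℕ} {p P : ℝ} (hP : 0 ≤ P)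
    (hconn : ∀ μ ∈ DGe (cube k) p, P ≤ μ.real {ω | (openGraph ω).Connected}) :
    ∀ μ ∈ DGe (cube (k + 1)) p,
      P ^ 2 - (1 - p) ^ 2 ^ k ≤ μ.real {ω | (openGraph ω).Connected} := by
  intro μ hμ
  have := hμ.1
  have h₀ := le_measure_blockConn hconn hμ _ (facet_injective k false)
  have h₁ := le_measure_blockConn hconn hμ _ (facet_injective k true)
  have hs := measure_blockSep_le hμ _ _ (facet_injective k false) (facet_injective k true)
    (facet_disjoint k) (facet_adj k)
  have hi := hμ.2.1.measure_inter (Set.finite_range _) (Set.finite_range _) (facet_disjoint k)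
    (determinedBy_blockConn (facet k false)) (determinedBy_blockConn (facet k true))
  have hsub : blockConn (facet k false) ∩ blockConn (facet k true) ⊆
      {ω | (openGraph ω).Connected} ∪ blockSep (facet k false) (facet k true) := by
    rintro ω ⟨h, h'⟩
    by_cases hω : ω ∈ blockSep (facet k false) (facet k true)
    · exact Or.inr hω
    · exact Or.inl (conn_of_facets h h' hω)
  have h2 := (measureReal_mono (μ := μ) hsub).trans (measureReal_union_le _ _)
  have h3 := mul_le_mul h₀ h₁ hP measureReal_nonneg
  nlinarith

/-- Above the golden ratio threshold, passing to larger cubes makes the squared connection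
probability dominate the separation probability by any prescribed factor. -/
lemma exists_conn_ratio {k : ℕ} (hk : 1 ≤ k) {p P : ℝ} (hp₁ : p ≤ 1)
    (hP : (1 - p) ^ (2 ^ (k - 1)) * Real.goldenRatio < P)
    (hconn : ∀ μ ∈ DGe (cube k) p, P ≤ μ.real {ω | (openGraph ω).Connected}) (C : ℝ) :
    ∃ (k' : ℕ) (P' : ℝ), 0 < P' ∧ C * (1 - p) ^ 2 ^ k' ≤ P' ^ 2 ∧
      ∀ μ ∈ DGe (cube k') p, P' ≤ μ.real {ω | (openGraph ω).Connected} := by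
  have hφ := Real.goldenRatio_pos
  have hφ1 := Real.one_lt_goldenRatio
  have hφ2 := Real.goldenRatio_sq
  have hq : 0 ≤ 1 - p := by linarith
  rcases hq.eq_or_lt with hq0 | hq0
  -- For `p = 1` the quotient by a power of `1 - p` is unavailable, but the separation term is zero
  -- and the given cube already suffices.
  · refine ⟨k, P, ?_, ?_, hconn⟩
    · refine lt_of_le_of_lt ?_ hP
      positivity
    · rw [← hq0, zero_pow (by positivity), mul_zero]
      positivity
  obtain ⟨m, rfl⟩ : ∃ m, k = m + 1 := ⟨k - 1, by omega⟩
  simp only [Nat.add_sub_cancel] at hP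
  set d : ℝ := P / (1 - p) ^ 2 ^ m - Real.goldenRatio with hd
  have hdpos : 0 < d := by
    rw [hd, sub_pos, lt_div_iff₀ (by positivity)]
    linarith
  -- The map `x ↦ x² - 1` fixes the golden ratio and has slope above `2` there, so each dimension
  -- step at least doubles the excess `d`.
  have key : ∀ j : ℕ, ∃ P' : ℝ, (Real.goldenRatio + 2 ^ j * d) * (1 - p) ^ 2 ^ (m + j) ≤ P' ∧
      ∀ μ ∈ DGe (cube (m + 1 + j)) p, P' ≤ μ.real {ω | (openGraph ω).Connected} := by
    intro j
    induction j with
    | zero =>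
      refine ⟨P, ?_, hconn⟩
      rw [hd]
      simp only [pow_zero, one_mul, add_zero, add_sub_cancel]
      rw [div_mul_cancel₀ _ (by positivity)]
    | succ j ih =>
      obtain ⟨P', h1, h2⟩ := ih
      have hs : 0 < (1 - p) ^ 2 ^ (m + j) := by positivity
      set s := (1 - p) ^ 2 ^ (m + j) with hsdef
      have hs2 : (1 - p) ^ 2 ^ (m + 1 + j) = s ^ 2 := by
        rw [hsdef, ← pow_mul, ← pow_succ]; congr 2; ring
      have he : 0 < 2 ^ j * d := by positivity
      set e := 2 ^ j * d with hedef
      have hP' : 0 ≤ P' := le_trans (by positivity) h1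
      refine ⟨P' ^ 2 - s ^ 2, ?_, ?_⟩
      · rw [show m + (j + 1) = m + 1 + j by ring, hs2, pow_succ,
          show (2 : ℝ) ^ j * 2 * d = 2 * e by rw [hedef]; ring]
        have h3 : ((Real.goldenRatio + e) * s) ^ 2 ≤ P' ^ 2 := by gcongr
        have h4 : Real.goldenRatio + 2 * e ≤ (Real.goldenRatio + e) ^ 2 - 1 := by nlinarith
        have h5 := mul_le_mul_of_nonneg_right h4 (sq_nonneg s)
        nlinarith
      · rw [← hs2]
        exact conn_succ hP' h2
  -- The `1` in the maximum ensures `x ≤ x²`, so that `C ≤ x` gives `C ≤ x²`.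
  obtain ⟨j, hj⟩ : ∃ j : ℕ, max C 1 ≤ 2 ^ j * d := by
    obtain ⟨j, hj⟩ := pow_unbounded_of_one_lt (max C 1 / d) (one_lt_two : (1 : ℝ) < 2)
    exact ⟨j, ((div_lt_iff₀ hdpos).1 hj).le⟩
  obtain ⟨P', h1, h2⟩ := key j
  have hs : 0 < (1 - p) ^ 2 ^ (m + j) := by positivity
  have hx : max C 1 ≤ Real.goldenRatio + 2 ^ j * d := by linarith
  have hx1 : 1 ≤ Real.goldenRatio + 2 ^ j * d := (le_max_right _ _).trans hx
  refine ⟨m + 1 + j, P', lt_of_lt_of_le (by positivity) h1, ?_, h2⟩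
  have hs2 : (1 - p) ^ 2 ^ (m + 1 + j) = ((1 - p) ^ 2 ^ (m + j)) ^ 2 := by
    rw [← pow_mul, ← pow_succ]; congr 2; ring
  rw [hs2]
  have h3 : ((Real.goldenRatio + 2 ^ j * d) * (1 - p) ^ 2 ^ (m + j)) ^ 2 ≤ P' ^ 2 := by gcongr
  refine le_trans ?_ h3
  rw [mul_pow]
  gcongr
  calc C ≤ max C 1 := le_max_left _ _
    _ ≤ Real.goldenRatio + 2 ^ j * d := hx
    _ ≤ _ := by nlinarith

end Doubling

/-! ### Families of disjoint blocks, conditioned on which are connected -/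

section Sites

variable {V : Type*} {G : SimpleGraph V} {k : ℕ} {σ : Type*}
  (β : σ → cube k →g G)

/-- Among the sites of `F`, exactly those of `A` have a connected block. -/
def exactConn (F A : Finset σ) : Set (Config G) :=
  {ω | ∀ s ∈ F, ω ∈ blockConn (β s) ↔ s ∈ A}

/-- The vertices of the blocks at the sites of `F`. -/
def blocks (F : Set σ) : Set V := ⋃ s ∈ F, Set.range (β s)

variable {β}

lemma range_subset_blocks {F : Set σ} {s : σ} (hs : s ∈ F) : Set.range (β s) ⊆ blocks β F :=
  Set.subset_biUnion_of_mem (u := fun s => Set.range (β s)) hs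

lemma blocks_finite {F : Set σ} (hF : F.Finite) : (blocks β F).Finite :=
  hF.biUnion fun _ _ => Set.finite_range _

lemma blocks_disjoint (hd : Pairwise fun u v => Disjoint (Set.range (β u)) (Set.range (β v)))
    {F F' : Set σ} (h : Disjoint F F') : Disjoint (blocks β F) (blocks β F') := by
  simp only [blocks, Set.disjoint_iUnion₂_right, Set.disjoint_iUnion₂_left]
  intro s hs t ht
  exact hd fun h' => Set.disjoint_left.1 h ht (h' ▸ hs)

lemma determinedBy_exactConn (F A : Finset σ) :
    DeterminedBy (blocks β F) (exactConn β F A) := by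
  intro ω ω' h hA s hs
  rw [← hA s hs]
  have h1 := (determinedBy_blockConn (β s)).mono (range_subset_blocks (F := (F : Set σ)) hs)
  exact ⟨h1 ω' ω fun e he => (h e he).symm, h1 ω ω' h⟩

variable {p P q : ℝ} {μ : Measure (Config G)}

/-- Conditionally on the set of sites with connected blocks, two blocks that are both connected
are separated with probability at most `q / P²`. -/
lemma measure_exactConn_inter_sep_le (hμ : μ ∈ DGe G p)
    (hd : Pairwise fun u v => Disjoint (Set.range (β u)) (Set.range (β v))) (hP : 0 < P)
    (hconn : ∀ s, P ≤ μ.real (blockConn (β s))) {F A : Finset σ} {u v : σ} (huv : u ≠ v)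
    (hu : u ∈ F) (hv : v ∈ F) (huA : u ∈ A) (hvA : v ∈ A)
    (hq : μ.real (blockSep (β u) (β v)) ≤ q) :
    μ.real (exactConn β F A ∩ blockSep (β u) (β v)) ≤ q / P ^ 2 * μ.real (exactConn β F A) := by
  classical
  have := hμ.1
  set F' := F \ {u, v} with hF'
  have hdis : Disjoint (F' : Set σ) {u, v} := by
    rw [hF', Set.disjoint_left]
    intro s hs
    simpa using (Finset.mem_sdiff.1 hs).2
  -- The pattern splits into the blocks `u`, `v` and the remaining blocks. Separation of `u` from
  -- `v` is independent of the latter, so their factor cancels from the conditional probability.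
  have heq : exactConn β F A = exactConn β F' A ∩ (blockConn (β u) ∩ blockConn (β v)) := by
    ext ω
    constructor
    · intro h
      exact ⟨fun s hs => h s (Finset.sdiff_subset hs), (h u hu).2 huA, (h v hv).2 hvA⟩
    · rintro ⟨h1, h2, h3⟩ s hs
      by_cases hsu : s = u
      · subst hsu; exact iff_of_true h2 huA
      by_cases hsv : s = v
      · subst hsv; exact iff_of_true h3 hvA
      exact h1 s (by simp [hF', hs, hsu, hsv])
  have hfin : (blocks β ({u, v} : Set σ)).Finite := blocks_finite (Set.toFinite _)
  have hru : Set.range (β u) ⊆ blocks β ({u, v} : Set σ) := range_subset_blocks (by simp)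
  have hrv : Set.range (β v) ⊆ blocks β ({u, v} : Set σ) := range_subset_blocks (by simp)
  have h1 : μ.real (exactConn β F' A ∩ blockSep (β u) (β v)) =
      μ.real (exactConn β F' A) * μ.real (blockSep (β u) (β v)) :=
    hμ.2.1.measure_inter (blocks_finite F'.finite_toSet) hfin (blocks_disjoint hd hdis)
      (determinedBy_exactConn _ _) ((determinedBy_blockSep _ _).mono (Set.union_subset hru hrv))
  have h2 : μ.real (exactConn β F A) = μ.real (exactConn β F' A) *
      (μ.real (blockConn (β u)) * μ.real (blockConn (β v))) := by
    rw [heq, hμ.2.1.measure_inter (blocks_finite F'.finite_toSet) hfin (blocks_disjoint hd hdis)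
      (determinedBy_exactConn _ _) (((determinedBy_blockConn _).mono hru).inter
        ((determinedBy_blockConn _).mono hrv)),
      hμ.2.1.measure_inter (Set.finite_range _) (Set.finite_range _) (hd huv)
        (determinedBy_blockConn _) (determinedBy_blockConn _)]
  have h3 : P ^ 2 ≤ μ.real (blockConn (β u)) * μ.real (blockConn (β v)) := by
    rw [sq]
    exact mul_le_mul (hconn u) (hconn v) hP.le measureReal_nonneg
  have hq0 : 0 ≤ q := measureReal_nonneg.trans hq
  calc μ.real (exactConn β F A ∩ blockSep (β u) (β v))
      ≤ μ.real (exactConn β F' A ∩ blockSep (β u) (β v)) :=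
        measureReal_mono (Set.inter_subset_inter_left _ (heq ▸ Set.inter_subset_left))
    _ ≤ μ.real (exactConn β F' A) * q := by
        rw [h1]; exact mul_le_mul_of_nonneg_left hq measureReal_nonneg
    _ = q / P ^ 2 * (μ.real (exactConn β F' A) * P ^ 2) := by field_simp
    _ ≤ q / P ^ 2 * μ.real (exactConn β F A) := by
        rw [h2]; gcongr

lemma sum_measure_exactConn_le [IsProbabilityMeasure μ] (F : Finset σ)
    (𝒜 : Finset (Finset σ)) (h𝒜 : 𝒜 ⊆ F.powerset) :
    ∑ A ∈ 𝒜, μ.real (exactConn β F A) ≤ 1 := by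
  rw [← measureReal_biUnion_finset]
  · exact measureReal_le_one
  · intro A hA B hB hAB
    refine Set.disjoint_left.2 fun ω h h' => hAB ?_
    have hA' := Finset.mem_powerset.1 (h𝒜 hA)
    have hB' := Finset.mem_powerset.1 (h𝒜 hB)
    ext s
    exact ⟨fun hs => (h' s (hA' hs)).1 ((h s (hA' hs)).2 hs),
      fun hs => (h s (hB' hs)).1 ((h' s (hB' hs)).2 hs)⟩
  · intro A _
    exact (determinedBy_exactConn F A).measurableSet (blocks_finite F.finite_toSet)

/-- If for every set `A` of connected sites at most `N` pairs of sites in `A` are selected, then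
some selected pair is separated with probability at most `N q / P²`. -/
lemma measure_selected_sep_le (hμ : μ ∈ DGe G p)
    (hd : Pairwise fun u v => Disjoint (Set.range (β u)) (Set.range (β v))) (hP : 0 < P)
    (hconn : ∀ s, P ≤ μ.real (blockConn (β s))) (F : Finset σ) (𝒜 : Finset (Finset σ))
    (h𝒜 : 𝒜 ⊆ F.powerset) (E : Finset σ → Finset (σ × σ)) (N : ℕ)
    (hE : ∀ A ∈ 𝒜, (E A).card ≤ N)
    (hE' : ∀ A ∈ 𝒜, ∀ e ∈ E A, e.1 ∈ A ∧ e.2 ∈ A ∧ e.1 ≠ e.2 ∧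
      μ.real (blockSep (β e.1) (β e.2)) ≤ q) (hq : 0 ≤ q) :
    μ.real (⋃ A ∈ 𝒜, ⋃ e ∈ E A, exactConn β F A ∩ blockSep (β e.1) (β e.2)) ≤
      N * (q / P ^ 2) := by
  have := hμ.1
  -- The union bound over patterns costs nothing: the patterns are disjoint events, so their
  -- probabilities sum to at most `1`. Only the at most `N` pairs within one pattern contribute a
  -- factor.
  calc μ.real (⋃ A ∈ 𝒜, ⋃ e ∈ E A, exactConn β F A ∩ blockSep (β e.1) (β e.2))
      ≤ ∑ A ∈ 𝒜, μ.real (⋃ e ∈ E A, exactConn β F A ∩ blockSep (β e.1) (β e.2)) :=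
        measureReal_biUnion_finset_le _ _
    _ ≤ ∑ A ∈ 𝒜, ∑ e ∈ E A, μ.real (exactConn β F A ∩ blockSep (β e.1) (β e.2)) :=
        Finset.sum_le_sum fun A _ => measureReal_biUnion_finset_le _ _
    _ ≤ ∑ A ∈ 𝒜, ∑ e ∈ E A, q / P ^ 2 * μ.real (exactConn β F A) := by
        refine Finset.sum_le_sum fun A hA => Finset.sum_le_sum fun e he => ?_
        obtain ⟨h1, h2, h3, h4⟩ := hE' A hA e he
        have hAF := Finset.mem_powerset.1 (h𝒜 hA)
        exact measure_exactConn_inter_sep_le hμ hd hP hconn h3 (hAF h1) (hAF h2) h1 h2 h4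
    _ ≤ ∑ A ∈ 𝒜, N * (q / P ^ 2 * μ.real (exactConn β F A)) := by
        refine Finset.sum_le_sum fun A hA => ?_
        rw [Finset.sum_const, nsmul_eq_mul]
        have := hE A hA
        gcongr
    _ = N * (q / P ^ 2) * ∑ A ∈ 𝒜, μ.real (exactConn β F A) := by
        rw [Finset.mul_sum]
        exact Finset.sum_congr rfl fun A _ => by ring
    _ ≤ N * (q / P ^ 2) * 1 := by
        have := sum_measure_exactConn_le (β := β) (μ := μ) F 𝒜 h𝒜
        gcongr
    _ = N * (q / P ^ 2) := mul_one _

/-- All blocks at the sites of `T` are connected with probability at least `P ^ #T`. -/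
lemma pow_le_measure_all_conn (hμ : μ ∈ DGe G p)
    (hd : Pairwise fun u v => Disjoint (Set.range (β u)) (Set.range (β v))) (hP : 0 ≤ P)
    (hconn : ∀ s, P ≤ μ.real (blockConn (β s))) (T : Finset σ) :
    P ^ T.card ≤ μ.real (⋂ s ∈ T, blockConn (β s)) := by
  have := hμ.1
  rw [hμ.2.1.measure_biInter T (R := fun s => Set.range (β s)) (fun _ _ => Set.finite_range _)
    (fun s _ t _ hst => hd hst) (fun s _ => determinedBy_blockConn _), ← Finset.prod_const]
  exact Finset.prod_le_prod (fun _ _ => hP) fun s _ => hconn s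

/-- If the sets `T i` of at most `N` sites are pairwise disjoint, then each of them has a
disconnected block with probability at most `(1 - P ^ N) ^ #I`. -/
lemma measure_none_conn_le (hμ : μ ∈ DGe G p)
    (hd : Pairwise fun u v => Disjoint (Set.range (β u)) (Set.range (β v))) (hP : 0 ≤ P)
    (hP₁ : P ≤ 1)
    (hconn : ∀ s, P ≤ μ.real (blockConn (β s))) {ι : Type*} (I : Finset ι)
    (T : ι → Finset σ) (N : ℕ) (hN : ∀ i, (T i).card ≤ N)
    (hT : Pairwise fun i j => Disjoint (T i) (T j)) :
    μ.real (⋂ i ∈ I, (⋂ s ∈ T i, blockConn (β s))ᶜ) ≤ (1 - P ^ N) ^ I.card := by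
  have := hμ.1
  have hdet : ∀ i, DeterminedBy (blocks β (T i)) (⋂ s ∈ T i, blockConn (β s)) := fun i =>
    DeterminedBy.iInter fun s => DeterminedBy.iInter fun hs =>
      (determinedBy_blockConn (β s)).mono (range_subset_blocks (F := (T i : Set σ)) hs)
  rw [hμ.2.1.measure_biInter I (R := fun i => blocks β (T i))
    (fun i _ => blocks_finite (T i).finite_toSet)
    (fun i _ j _ hij => blocks_disjoint hd (Finset.disjoint_coe.2 (hT hij)))
    (fun i _ => (hdet i).compl), ← Finset.prod_const]
  refine Finset.prod_le_prod (fun _ _ => measureReal_nonneg) fun i _ => ?_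
  rw [probReal_compl_eq_one_sub ((hdet i).measurableSet (blocks_finite (T i).finite_toSet))]
  linarith [pow_le_measure_all_conn hμ hd hP hconn (T i), pow_le_pow_of_le_one hP hP₁ (hN i)]

end Sites

/-! ### Hubs, routes and coarse edges -/

section Coarse

variable {V : Type*} {G : SimpleGraph V} {k l M : ℕ}

/-- Sites: a position in the plane together with a vertex of a product of two stars. -/
abbrev Site (l M : ℕ) : Type := (ℤ × ℤ) × Option (Fin l) × Option (Fin M)

/-- The consecutive pairs of the `r`-th route from the `i`-th candidate hub of `x` to the `j`-th
candidate hub of `y`. -/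
def routeEdges (x y : ℤ × ℤ) (i j : Fin l) (r : Fin M) : Finset (Site l M × Site l M) :=
  {((x, some i, none), (x, some i, some r)), ((x, some i, some r), (x, none, some r)),
    ((x, none, some r), (y, none, some r)), ((y, none, some r), (y, some j, some r)),
    ((y, some j, some r), (y, some j, none))}

/-- The inner sites of the `r`-th route. -/
def routeSites (x y : ℤ × ℤ) (i j : Fin l) (r : Fin M) : Finset (Site l M) :=
  {(x, some i, some r), (x, none, some r), (y, none, some r), (y, some j, some r)}

variable (β : Site l M → cube k →g G)

/-- The hub of `x` is its first candidate with a connected block. -/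
def isHub (x : ℤ × ℤ) (i : Fin l) : Set (Config G) :=
  {ω | ω ∈ blockConn (β (x, some i, none)) ∧
    ∀ i' < i, ω ∉ blockConn (β (x, some i', none))}

/-- The hubs of `x` and `y` exist and are joined along some route. -/
def coarseOpen (x y : ℤ × ℤ) : Set (Config G) :=
  ⋃ i : Fin l, ⋃ j : Fin l, ⋃ r : Fin M, isHub β x i ∩ isHub β y j ∩
    ⋂ e ∈ routeEdges x y i j r,
      (blockConn (β e.1) ∩ blockConn (β e.2) ∩ (blockSep (β e.1) (β e.2))ᶜ)

/-- The vertices of the blocks at the sites over `x`. -/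
def cell (x : ℤ × ℤ) : Set V := blocks β {s : Site l M | s.1 = x}

variable {β}

lemma cell_finite (x : ℤ × ℤ) : (cell β x).Finite :=
  blocks_finite (((Set.finite_singleton x).prod Set.finite_univ).subset
    fun _ hs => ⟨hs, Set.mem_univ _⟩)

lemma cell_disjoint (hd : Pairwise fun u v => Disjoint (Set.range (β u)) (Set.range (β v)))
    {x y : ℤ × ℤ} (h : x ≠ y) : Disjoint (cell β x) (cell β y) :=
  blocks_disjoint hd (Set.disjoint_left.2 fun _ hs hs' => h (hs.symm.trans hs'))

lemma range_subset_cell {s : Site l M} {x : ℤ × ℤ} (h : s.1 = x) :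
    Set.range (β s) ⊆ cell β x :=
  range_subset_blocks (F := {s : Site l M | s.1 = x}) h

lemma routeEdges_fst {x y : ℤ × ℤ} {i j : Fin l} {r : Fin M} {e : Site l M × Site l M}
    (he : e ∈ routeEdges x y i j r) :
    (e.1.1 = x ∨ e.1.1 = y) ∧ (e.2.1 = x ∨ e.2.1 = y) := by
  simp only [routeEdges, Finset.mem_insert, Finset.mem_singleton] at he
  rcases he with rfl | rfl | rfl | rfl | rfl <;> simp

lemma determinedBy_isHub (x : ℤ × ℤ) (i : Fin l) : DeterminedBy (cell β x) (isHub β x i) := by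
  have h : ∀ i, DeterminedBy (cell β x) (blockConn (β (x, some i, none))) := fun i =>
    (determinedBy_blockConn _).mono (range_subset_blocks rfl)
  intro ω ω' hω hA
  exact ⟨h i ω ω' hω hA.1, fun i' hi' => (h i').compl ω ω' hω (hA.2 i' hi')⟩

lemma determinedBy_coarseOpen (x y : ℤ × ℤ) :
    DeterminedBy (cell β x ∪ cell β y) (coarseOpen β x y) := by
  have hc : ∀ s : Site l M, s.1 = x ∨ s.1 = y → Set.range (β s) ⊆ cell β x ∪ cell β y := by
    rintro s (hs | hs)
    · exact (range_subset_cell hs).trans Set.subset_union_left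
    · exact (range_subset_cell hs).trans Set.subset_union_right
  refine DeterminedBy.iUnion fun i => DeterminedBy.iUnion fun j => DeterminedBy.iUnion fun r =>
    (((determinedBy_isHub x i).mono Set.subset_union_left).inter
      ((determinedBy_isHub y j).mono Set.subset_union_right)).inter ?_
  refine DeterminedBy.iInter fun e => DeterminedBy.iInter fun he => ?_
  obtain ⟨h1, h2⟩ := routeEdges_fst he
  exact (((determinedBy_blockConn _).mono (hc _ h1)).inter
    ((determinedBy_blockConn _).mono (hc _ h2))).inter
    ((determinedBy_blockSep _ _).mono (Set.union_subset (hc _ h1) (hc _ h2))).compl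

lemma isHub_unique {x : ℤ × ℤ} {i j : Fin l} {ω : Config G} (hi : ω ∈ isHub β x i)
    (hj : ω ∈ isHub β x j) : i = j := by
  rcases lt_trichotomy i j with h | h | h
  · exact absurd hi.1 (hj.2 i h)
  · exact h
  · exact absurd hj.1 (hi.2 j h)

lemma coarseOpen.reachable {x y : ℤ × ℤ} {ω : Config G} (h : ω ∈ coarseOpen β x y) :
    ∃ i j : Fin l, ω ∈ isHub β x i ∧ ω ∈ isHub β y j ∧
      ∀ c c', (openGraph ω).Reachable (β (x, some i, none) c) (β (y, some j, none) c') := by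
  simp only [coarseOpen, Set.mem_iUnion] at h
  obtain ⟨i, j, r, ⟨hi, hj⟩, h⟩ := h
  refine ⟨i, j, hi, hj, fun c c' => ?_⟩
  simp only [Set.mem_iInter] at h
  have key : ∀ e ∈ routeEdges x y i j r, ∀ c c',
      (openGraph ω).Reachable (β e.1 c) (β e.2 c') :=
    fun e he => reachable_of_blocks (h e he).1.1 (h e he).1.2 (h e he).2
  have h1 := key ((x, some i, none), (x, some i, some r)) (by simp [routeEdges]) c c
  have h2 := key ((x, some i, some r), (x, none, some r)) (by simp [routeEdges]) c c
  have h3 := key ((x, none, some r), (y, none, some r)) (by simp [routeEdges]) c c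
  have h4 := key ((y, none, some r), (y, some j, some r)) (by simp [routeEdges]) c c
  have h5 := key ((y, some j, some r), (y, some j, none)) (by simp [routeEdges]) c c'
  exact (((h1.trans h2).trans h3).trans h4).trans h5

lemma routeEdges_card_le (x y : ℤ × ℤ) (i j : Fin l) (r : Fin M) :
    (routeEdges x y i j r).card ≤ 5 := Finset.card_le_five

lemma routeSites_card_le (x y : ℤ × ℤ) (i j : Fin l) (r : Fin M) :
    (routeSites x y i j r).card ≤ 4 := Finset.card_le_four

/-- All inner sites of a route carry the label `r` in the second star. Distinct routes thus succeed
independently. -/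
lemma routeSites_disjoint (x y : ℤ × ℤ) (i j : Fin l) :
    Pairwise fun r r' : Fin M => Disjoint (routeSites x y i j r) (routeSites x y i j r') := by
  intro r r' hr
  have key : ∀ r : Fin M, ∀ s ∈ routeSites x y i j r, s.2.2 = some r := by
    intro r s hs
    simp only [routeSites, Finset.mem_insert, Finset.mem_singleton] at hs
    rcases hs with rfl | rfl | rfl | rfl <;> rfl
  refine Finset.disjoint_left.2 fun s hs hs' => hr ?_
  exact Option.some_injective _ ((key r s hs).symm.trans (key r' s hs'))

variable {p P : ℝ} {μ : Measure (Config G)}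

/-- The set of sites `A` contains the first candidates `i` and `j` of `x` and `y` that it meets,
and all inner sites of the `r`-th route between them. -/
def IsRoute (x y : ℤ × ℤ) (A : Finset (Site l M)) (t : Fin l × Fin l × Fin M) : Prop :=
  ((x, some t.1, none) ∈ A ∧ ∀ i' < t.1, (x, some i', none) ∉ A) ∧
  ((y, some t.2.1, none) ∈ A ∧ ∀ j' < t.2.1, (y, some j', none) ∉ A) ∧
  routeSites x y t.1 t.2.1 t.2.2 ⊆ A

lemma IsRoute.edges_mem {x y : ℤ × ℤ} {A : Finset (Site l M)} {t : Fin l × Fin l × Fin M}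
    (h : IsRoute x y A t) {e : Site l M × Site l M}
    (he : e ∈ routeEdges x y t.1 t.2.1 t.2.2) : e.1 ∈ A ∧ e.2 ∈ A := by
  obtain ⟨⟨h1, -⟩, ⟨h2, -⟩, h3⟩ := h
  simp only [routeSites, Finset.insert_subset_iff, Finset.singleton_subset_iff] at h3
  simp only [routeEdges, Finset.mem_insert, Finset.mem_singleton] at he
  obtain ⟨h4, h5, h6, h7⟩ := h3
  rcases he with rfl | rfl | rfl | rfl | rfl <;> constructor <;> assumption

/-- A coarse edge is closed only with small probability. -/
lemma measure_compl_coarseOpen_le (hμ : μ ∈ DGe G p) (hp₁ : p ≤ 1)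
    (hβ : ∀ s, Function.Injective (β s))
    (hd : Pairwise fun u v => Disjoint (Set.range (β u)) (Set.range (β v))) (hP : 0 < P)
    (hconn : ∀ s, P ≤ μ.real (blockConn (β s))) {x y : ℤ × ℤ}
    (hadj : ∀ i j r, ∀ e ∈ routeEdges x y i j r, ∀ c, G.Adj (β e.1 c) (β e.2 c)) :
    μ.real (coarseOpen β x y)ᶜ ≤ 2 * (1 - P) ^ l + l ^ 2 * (1 - P ^ 4) ^ M +
      5 * ((1 - p) ^ 2 ^ k / P ^ 2) := by
  classical
  have := hμ.1
  have hP₁ : P ≤ 1 := (hconn (x, none, none)).trans measureReal_le_one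
  have hne : ∀ i j r, ∀ e ∈ routeEdges (l := l) (M := M) x y i j r, e.1 ≠ e.2 := by
    intro i j r e he h
    have := hadj i j r e he fun _ => false
    rw [h] at this
    exact G.loopless.irrefl _ this
  have hq : (0 : ℝ) ≤ (1 - p) ^ 2 ^ k := pow_nonneg (by linarith) _
  set F : Finset (Site l M) := ({x, y} : Finset (ℤ × ℤ)) ×ˢ Finset.univ with hF
  set 𝒜 : Finset (Finset (Site l M)) := F.powerset.filter fun A => ∃ t, IsRoute x y A t with h𝒜
  -- One route is fixed per pattern, as a function of the pattern alone, so only its five edges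
  -- enter the union bound.
  have hch : ∀ A : Finset (Site l M), ∃ E : Finset (Site l M × Site l M),
      (∃ t, IsRoute x y A t) →
        ∃ t, IsRoute x y A t ∧ E = routeEdges x y t.1 t.2.1 t.2.2 := by
    intro A
    by_cases h : ∃ t, IsRoute x y A t
    · obtain ⟨t, ht⟩ := h
      exact ⟨_, fun _ => ⟨t, ht, rfl⟩⟩
    · exact ⟨∅, fun h' => absurd h' h⟩
  choose E hE using hch
  have hfail : μ.real (⋃ A ∈ 𝒜, ⋃ e ∈ E A,
      exactConn β F A ∩ blockSep (β e.1) (β e.2)) ≤ (5 : ℕ) * ((1 - p) ^ 2 ^ k / P ^ 2) := by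
    refine measure_selected_sep_le hμ hd hP hconn F 𝒜 (Finset.filter_subset _ _) E 5 ?_ ?_ hq
    · intro A hA
      obtain ⟨t, -, h⟩ := hE A (Finset.mem_filter.1 hA).2
      rw [h]
      exact routeEdges_card_le _ _ _ _ _
    · intro A hA e he
      obtain ⟨t, ht, h⟩ := hE A (Finset.mem_filter.1 hA).2
      rw [h] at he
      refine ⟨(ht.edges_mem he).1, (ht.edges_mem he).2, hne _ _ _ e he, ?_⟩
      exact measure_blockSep_le hμ _ _ (hβ _) (hβ _) (hd (hne _ _ _ e he))
        (hadj _ _ _ e he)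
  have hhub : ∀ z : ℤ × ℤ, μ.real (⋂ i ∈ (Finset.univ : Finset (Fin l)),
      (⋂ s ∈ ({(z, some i, none)} : Finset (Site l M)), blockConn (β s))ᶜ) ≤ (1 - P) ^ l := by
    intro z
    have h := measure_none_conn_le hμ hd hP.le hP₁ hconn (Finset.univ : Finset (Fin l))
      (fun i => ({(z, some i, none)} : Finset (Site l M))) 1 (fun i => by simp) ?_
    · simpa using h
    · intro i j hij
      simpa using hij
  have hroute : ∀ i j : Fin l, μ.real (⋂ r ∈ (Finset.univ : Finset (Fin M)),
      (⋂ s ∈ routeSites x y i j r, blockConn (β s))ᶜ) ≤ (1 - P ^ 4) ^ M := by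
    intro i j
    have h := measure_none_conn_le hμ hd hP.le hP₁ hconn (Finset.univ : Finset (Fin M))
      (routeSites x y i j) 4 (routeSites_card_le x y i j) (routeSites_disjoint x y i j)
    simpa using h
  set noHub : ℤ × ℤ → Set (Config G) := fun z => ⋂ i ∈ (Finset.univ : Finset (Fin l)),
      (⋂ s ∈ ({(z, some i, none)} : Finset (Site l M)), blockConn (β s))ᶜ with hnoHub
  set noRoute : Fin l × Fin l → Set (Config G) := fun t =>
    ⋂ r ∈ (Finset.univ : Finset (Fin M)),
      (⋂ s ∈ routeSites x y t.1 t.2 r, blockConn (β s))ᶜ with hnoRoute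
  set fail := ⋃ A ∈ 𝒜, ⋃ e ∈ E A, exactConn β F A ∩ blockSep (β e.1) (β e.2) with hfaildef
  -- A closed coarse edge has one of these causes: a missing hub, no route with connected inner
  -- blocks for some pair of candidates, or a separated pair on the selected route.
  have hsub : (coarseOpen β x y)ᶜ ⊆ ((noHub x ∪ noHub y) ∪
      ⋃ t ∈ (Finset.univ : Finset (Fin l × Fin l)), noRoute t) ∪ fail := by
    intro ω hω
    by_contra hcon
    simp only [Set.mem_union, not_or] at hcon
    obtain ⟨⟨⟨hx, hy⟩, hr⟩, hf⟩ := hcon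
    have hub : ∀ z, ω ∉ noHub z → ∃ i, ω ∈ isHub β z i := by
      intro z hz
      have h1 : ∃ i : Fin l, ω ∈ blockConn (β (z, some i, none)) := by
        simpa [hnoHub] using hz
      obtain ⟨i, hi, hmin⟩ := WellFounded.has_min (wellFounded_lt (α := Fin l))
        {i | ω ∈ blockConn (β (z, some i, none))} h1
      exact ⟨i, hi, fun i' hi' h' => hmin i' h' hi'⟩
    obtain ⟨i, hi⟩ := hub x hx
    obtain ⟨j, hj⟩ := hub y hy
    have hr' : ω ∉ noRoute (i, j) := fun h => hr (Set.mem_biUnion (by simp) h)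
    obtain ⟨r, hr⟩ : ∃ r : Fin M, ∀ s ∈ routeSites x y i j r, ω ∈ blockConn (β s) := by
      by_contra! h
      refine hr' (Set.mem_iInter₂.2 fun r _ h' => ?_)
      obtain ⟨s, hs, hs'⟩ := h r
      exact hs' (Set.mem_iInter₂.1 h' s hs)
    set A := F.filter fun s => ω ∈ blockConn (β s) with hA
    have hFmem : ∀ s : Site l M, s ∈ F ↔ s.1 = x ∨ s.1 = y := by
      intro s
      simp [hF, Finset.mem_product]
    have hAmem : ∀ s : Site l M, s.1 = x ∨ s.1 = y → (s ∈ A ↔ ω ∈ blockConn (β s)) := by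
      intro s hs
      rw [hA, Finset.mem_filter, hFmem]
      exact and_iff_right hs
    have hex : ω ∈ exactConn β F A := fun s hs => (hAmem s ((hFmem s).1 hs)).symm
    have hrich : IsRoute x y A (i, j, r) := by
      refine ⟨⟨(hAmem _ (Or.inl rfl)).2 hi.1, fun i' h => ?_⟩,
        ⟨(hAmem _ (Or.inr rfl)).2 hj.1, fun i' h => ?_⟩, fun s hs => ?_⟩
      · rw [hAmem _ (Or.inl rfl)]; exact hi.2 i' h
      · rw [hAmem _ (Or.inr rfl)]; exact hj.2 i' h
      · refine (hAmem s ?_).2 (hr s hs)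
        simp only [routeSites, Finset.mem_insert, Finset.mem_singleton] at hs
        rcases hs with rfl | rfl | rfl | rfl <;> simp
    have hA𝒜 : A ∈ 𝒜 := by
      rw [h𝒜, Finset.mem_filter, Finset.mem_powerset]
      exact ⟨Finset.filter_subset _ _, _, hrich⟩
    -- The route found above only shows that the pattern admits one. The route `t` selected for the
    -- pattern may differ, and it is the one free of separated pairs.
    obtain ⟨t, ht, hEt⟩ := hE A ⟨_, hrich⟩
    refine hω ?_
    simp only [coarseOpen, Set.mem_iUnion]
    refine ⟨t.1, t.2.1, t.2.2, ⟨⟨(hAmem _ (Or.inl rfl)).1 ht.1.1, fun i' h => ?_⟩,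
      ⟨(hAmem _ (Or.inr rfl)).1 ht.2.1.1, fun i' h => ?_⟩⟩, ?_⟩
    · rw [← hAmem _ (Or.inl rfl)]; exact ht.1.2 i' h
    · rw [← hAmem _ (Or.inr rfl)]; exact ht.2.1.2 i' h
    · simp only [Set.mem_iInter]
      intro e he
      obtain ⟨h1, h2⟩ := routeEdges_fst he
      obtain ⟨h3, h4⟩ := ht.edges_mem he
      refine ⟨⟨(hAmem _ h1).1 h3, (hAmem _ h2).1 h4⟩, fun hs => hf ?_⟩
      rw [hfaildef]
      simp only [Set.mem_iUnion]
      exact ⟨A, hA𝒜, e, hEt ▸ he, hex, hs⟩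
  have h1 := (measureReal_mono (μ := μ) hsub).trans (measureReal_union_le _ _)
  have h2 := measureReal_union_le (μ := μ) (noHub x ∪ noHub y)
    (⋃ t ∈ (Finset.univ : Finset (Fin l × Fin l)), noRoute t)
  have h3 := measureReal_union_le (μ := μ) (noHub x) (noHub y)
  have h4 : μ.real (⋃ t ∈ (Finset.univ : Finset (Fin l × Fin l)), noRoute t) ≤
      l ^ 2 * (1 - P ^ 4) ^ M := by
    refine (measureReal_biUnion_finset_le _ _).trans ?_
    refine (Finset.sum_le_sum fun t _ => hroute t.1 t.2).trans (le_of_eq ?_)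
    rw [Finset.sum_const, nsmul_eq_mul]
    simp [sq]
  have h5 := hhub x
  have h6 := hhub y
  push_cast at hfail
  linarith

end Coarse

/-! ### Renormalisation on the square lattice -/

section Renormalization

/-- The unit vector of the plane in direction `d`. -/
def unitStep (d : Bool) : ℤ × ℤ := if d then (0, 1) else (1, 0)

/-- Edges of the square lattice, given by a lower endpoint and a direction. -/
abbrev PlaneEdge : Type := (ℤ × ℤ) × Bool

/-- The upper endpoint of an edge. -/
def PlaneEdge.top (f : PlaneEdge) : ℤ × ℤ := f.1 + unitStep f.2

/-- The point `w` is an endpoint of the edge `f`. -/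
def PlaneEdge.Touches (f : PlaneEdge) (w : ℤ × ℤ) : Prop := w = f.1 ∨ w = f.top

/-- The edges `f` and `g` share no endpoint. -/
def PlaneEdge.Apart (f g : PlaneEdge) : Prop := ∀ w, f.Touches w → ¬ g.Touches w

/-- The index of the `2 × 2` block that contains a point. -/
def half (a : ℤ × ℤ) : ℤ × ℤ := (a.1 / 2, a.2 / 2)

/-- The points in the two blocks joined by an edge. -/
noncomputable def grid (f : PlaneEdge) : Finset (ℤ × ℤ) :=
  Finset.Icc (2 * f.1.1) (2 * f.top.1 + 1) ×ˢ Finset.Icc (2 * f.1.2) (2 * f.top.2 + 1)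

/-- The edges between points of the two blocks joined by an edge. -/
noncomputable def subEdges (f : PlaneEdge) : Finset PlaneEdge :=
  (grid f ×ˢ Finset.univ).filter fun g => PlaneEdge.top g ∈ grid f

lemma mem_grid {f : PlaneEdge} {a : ℤ × ℤ} : a ∈ grid f ↔ half a = f.1 ∨ half a = f.top := by
  obtain ⟨⟨x, y⟩, d⟩ := f
  obtain ⟨a, b⟩ := a
  cases d <;>
    simp only [grid, PlaneEdge.top, unitStep, half, Finset.mem_product, Finset.mem_Icc,
      Prod.mk.injEq, Prod.mk_add_mk, if_true, if_false, Bool.false_eq_true] <;> omega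

lemma card_subEdges_le (f : PlaneEdge) : (subEdges f).card ≤ 16 := by
  refine (Finset.card_filter_le _ _).trans ?_
  obtain ⟨⟨x, y⟩, d⟩ := f
  rw [Finset.card_product, grid, Finset.card_product]
  cases d <;> simp [PlaneEdge.top, unitStep] <;> ring_nf <;> simp

lemma mem_subEdges {f g : PlaneEdge} : g ∈ subEdges f ↔ g.1 ∈ grid f ∧ g.top ∈ grid f := by
  simp [subEdges]

/-- The square lattice is bipartite by the parity of the coordinate sum. -/
lemma touches_parity {f : PlaneEdge} {u v : ℤ × ℤ} (hu : f.Touches u) (hv : f.Touches v)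
    (huv : u ≠ v) : (u.1 + u.2) % 2 ≠ (v.1 + v.2) % 2 := by
  obtain ⟨⟨x, y⟩, d⟩ := f
  rcases hu with rfl | rfl <;> rcases hv with rfl | rfl <;>
    first
    | exact absurd rfl huv
    | (cases d <;> simp [PlaneEdge.top, unitStep] <;> omega)

/-- Pairwise intersecting edges of the square lattice all pass through one point. -/
lemma exists_common_endpoint {S : Set PlaneEdge}
    (h : ∀ f ∈ S, ∀ g ∈ S, ¬ PlaneEdge.Apart f g) : ∃ w, ∀ f ∈ S, f.Touches w := by
  rcases S.eq_empty_or_nonempty with rfl | ⟨f₀, h₀⟩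
  · exact ⟨0, by simp⟩
  by_contra! hcon
  obtain ⟨f₁, h₁, hf₁⟩ := hcon f₀.1
  obtain ⟨f₂, h₂, hf₂⟩ := hcon f₀.top
  have common : ∀ f ∈ S, ∀ g ∈ S, ∃ w, f.Touches w ∧ g.Touches w := by
    intro f hf g hg
    have := h f hf g hg
    unfold PlaneEdge.Apart at this
    push Not at this
    exact this
  have ht₁ : f₁.Touches f₀.top := by
    obtain ⟨w, hw, hw'⟩ := common f₀ h₀ f₁ h₁
    rcases hw with rfl | rfl
    · exact absurd hw' hf₁
    · exact hw'
  have ht₂ : f₂.Touches f₀.1 := by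
    obtain ⟨w, hw, hw'⟩ := common f₀ h₀ f₂ h₂
    rcases hw with rfl | rfl
    · exact hw'
    · exact absurd hw' hf₂
  -- The three edges would form a triangle, and three points cannot have pairwise different
  -- parities.
  obtain ⟨w, hw₁, hw₂⟩ := common f₁ h₁ f₂ h₂
  have e₁ := touches_parity hw₁ ht₁ (by rintro rfl; exact hf₂ hw₂)
  have e₂ := touches_parity hw₂ ht₂ (by rintro rfl; exact hf₁ hw₁)
  have e₀ := touches_parity (f := f₀) (Or.inl rfl) (Or.inr rfl)
    (by intro h; rw [h] at hf₁; exact hf₁ ht₁)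
  omega

/-- A function on a rectangle with sides at least two that is constant along all edges avoiding
`w` is constant away from `w`. -/
lemma rectangle_const {α : Type*} (c : ℤ × ℤ → α) {x₀ x₁ y₀ y₁ : ℤ} (hx : x₀ < x₁) (hy : y₀ < y₁)
    (w : ℤ × ℤ)
    (hH : ∀ x y, x₀ ≤ x → x < x₁ → y₀ ≤ y → y ≤ y₁ → (x, y) ≠ w → (x + 1, y) ≠ w →
      c (x, y) = c (x + 1, y))
    (hV : ∀ x y, x₀ ≤ x → x ≤ x₁ → y₀ ≤ y → y < y₁ → (x, y) ≠ w → (x, y + 1) ≠ w →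
      c (x, y) = c (x, y + 1)) :
    ∃ γ, ∀ x y, x₀ ≤ x → x ≤ x₁ → y₀ ≤ y → y ≤ y₁ → (x, y) ≠ w → c (x, y) = γ := by
  obtain ⟨w₁, w₂⟩ := w
  -- Every row and every column missing `w` is monochromatic, and any point other than `w` lies on
  -- such a line.
  have row : ∀ y, y₀ ≤ y → y ≤ y₁ → y ≠ w₂ → ∀ x, x₀ ≤ x → x ≤ x₁ → c (x₀, y) = c (x, y) := by
    intro y h1 h2 h3 x hx0
    induction x, hx0 using Int.leInduction with
    | base => exact fun _ => rfl
    | succ n hn ih =>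
      intro hn1
      rw [ih (by omega), hH n y hn (by omega) h1 h2 (by simp [h3]) (by simp [h3])]
  have col : ∀ x, x₀ ≤ x → x ≤ x₁ → x ≠ w₁ → ∀ y, y₀ ≤ y → y ≤ y₁ → c (x, y₀) = c (x, y) := by
    intro x h1 h2 h3 y hy0
    induction y, hy0 using Int.leInduction with
    | base => exact fun _ => rfl
    | succ n hn ih =>
      intro hn1
      rw [ih (by omega), hV x n h1 h2 hn (by omega) (by simp [h3]) (by simp [h3])]
  obtain ⟨x', hx1, hx2, hx3⟩ : ∃ x', x₀ ≤ x' ∧ x' ≤ x₁ ∧ x' ≠ w₁ := by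
    by_cases h : x₀ = w₁
    · exact ⟨x₁, by omega, by omega, by omega⟩
    · exact ⟨x₀, by omega, by omega, h⟩
  obtain ⟨y', hy1, hy2, hy3⟩ : ∃ y', y₀ ≤ y' ∧ y' ≤ y₁ ∧ y' ≠ w₂ := by
    by_cases h : y₀ = w₂
    · exact ⟨y₁, by omega, by omega, by omega⟩
    · exact ⟨y₀, by omega, by omega, h⟩
  refine ⟨c (x', y'), fun x y h1 h2 h3 h4 hne => ?_⟩
  by_cases h : y = w₂
  · have h' : x ≠ w₁ := fun h' => hne (by rw [h, h'])
    rw [← col x h1 h2 h' y h3 h4, col x h1 h2 h' y' hy1 hy2, ← row y' hy1 hy2 hy3 x h1 h2,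
      row y' hy1 hy2 hy3 x' hx1 hx2]
  · rw [← row y h3 h4 h x h1 h2, row y h3 h4 h x' hx1 hx2, ← col x' hx1 hx2 hx3 y h3 h4,
      col x' hx1 hx2 hx3 y' hy1 hy2]

section Colour

variable {α : Type*}

/-- All points of the block `b`, with at most one exception, have colour `γ`. -/
def MajorColour (c : ℤ × ℤ → α) (b : ℤ × ℤ) (γ : α) : Prop :=
  ∃ w, ∀ a, half a = b → a ≠ w → c a = γ

lemma exists_half_eq_ne (b w w' : ℤ × ℤ) : ∃ a, half a = b ∧ a ≠ w ∧ a ≠ w' := by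
  obtain ⟨x, y⟩ := b
  by_contra! h
  have h1 := h (2 * x, 2 * y) (by simp [half])
  have h2 := h (2 * x + 1, 2 * y) (by simp [half]; omega)
  have h3 := h (2 * x, 2 * y + 1) (by simp [half]; omega)
  obtain ⟨a, b⟩ := w
  obtain ⟨a', b'⟩ := w'
  simp only [ne_eq, Prod.mk.injEq] at h1 h2 h3
  omega

lemma MajorColour.unique {c : ℤ × ℤ → α} {b : ℤ × ℤ} {γ γ' : α} (h : MajorColour c b γ)
    (h' : MajorColour c b γ') : γ = γ' := by
  obtain ⟨w, hw⟩ := h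
  obtain ⟨w', hw'⟩ := h'
  obtain ⟨a, ha, h1, h2⟩ := exists_half_eq_ne b w w'
  rw [← hw a ha h1, hw' a ha h2]

open Classical in
/-- The colour of a block: its majority colour if there is one. -/
noncomputable def recolour (c : ℤ × ℤ → α) (b : ℤ × ℤ) : α :=
  if h : ∃ γ, MajorColour c b γ then h.choose else c (2 * b.1, 2 * b.2)

lemma recolour_eq {c : ℤ × ℤ → α} {b : ℤ × ℤ} {γ : α} (h : MajorColour c b γ) :
    recolour c b = γ := by
  have h' : ∃ γ, MajorColour c b γ := ⟨γ, h⟩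
  rw [recolour, dif_pos h']
  exact h'.choose_spec.unique h

lemma exists_recolour_eq (c : ℤ × ℤ → α) (b : ℤ × ℤ) : ∃ a, half a = b ∧ c a = recolour c b := by
  by_cases h : ∃ γ, MajorColour c b γ
  · obtain ⟨γ, w, hw⟩ := h
    obtain ⟨a, ha, h1, -⟩ := exists_half_eq_ne b w w
    exact ⟨a, ha, by rw [hw a ha h1, recolour_eq ⟨w, hw⟩]⟩
  · exact ⟨(2 * b.1, 2 * b.2), by simp [half], by rw [recolour, dif_neg h]⟩

/-- A recoloured block always takes the colour of one of its points, even by the default value. A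
colour at any scale is thus realised by an original point below it. -/
lemma exists_iterate_recolour_eq (c : ℤ × ℤ → α) (j : ℕ) (b : ℤ × ℤ) :
    ∃ a, half^[j] a = b ∧ c a = recolour^[j] c b := by
  induction j generalizing b with
  | zero => exact ⟨b, rfl, rfl⟩
  | succ j ih =>
    obtain ⟨a, ha, h⟩ := exists_recolour_eq (recolour^[j] c) b
    obtain ⟨a', ha', h'⟩ := ih a
    refine ⟨a', ?_, ?_⟩
    · rw [Function.iterate_succ_apply', ha', ha]
    · rw [Function.iterate_succ_apply', h', h]

variable {Ω : Type*}

/-- A coarse edge is open if there are no two closed edges without common endpoint between the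
points of its two blocks. -/
def renorm (O : PlaneEdge → Set Ω) (f : PlaneEdge) : Set Ω :=
  {ω | ∀ g ∈ subEdges f, ∀ g' ∈ subEdges f, PlaneEdge.Apart g g' → ω ∈ O g ∨ ω ∈ O g'}

/-- The colouring is constant along the open edges. -/
def Compatible (O : PlaneEdge → Set Ω) (ω : Ω) (c : ℤ × ℤ → α) : Prop :=
  ∀ f, ω ∈ O f → c f.1 = c f.top

/-- Closed edges in the two blocks pairwise meet, hence all pass through one point `w`. Away from
`w` the rectangle has a single colour, which is the majority colour of both blocks. -/
lemma Compatible.renorm {O : PlaneEdge → Set Ω} {ω : Ω} {c : ℤ × ℤ → α}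
    (h : Compatible O ω c) : Compatible (renorm O) ω (recolour c) := by
  intro f hf
  obtain ⟨w, hw⟩ := exists_common_endpoint (S := {g | g ∈ subEdges f ∧ ω ∉ O g}) (by
    rintro g ⟨hg, hg'⟩ g' ⟨hg₁, hg₁'⟩ hap
    exact (hf g hg g' hg₁ hap).elim hg' hg₁')
  have hopen : ∀ g ∈ subEdges f, ¬ g.Touches w → c g.1 = c g.top := by
    intro g hg hgw
    refine h g ?_
    by_contra hg'
    exact hgw (hw g ⟨hg, hg'⟩)
  have htop : f.1.1 ≤ f.top.1 ∧ f.1.2 ≤ f.top.2 := by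
    obtain ⟨⟨x, y⟩, d⟩ := f
    cases d <;> simp [PlaneEdge.top, unitStep]
  have hgrid : ∀ x y, (x, y) ∈ grid f ↔ (2 * f.1.1 ≤ x ∧ x ≤ 2 * f.top.1 + 1) ∧
      2 * f.1.2 ≤ y ∧ y ≤ 2 * f.top.2 + 1 := by
    intro x y
    simp [grid]
  obtain ⟨γ, hγ⟩ := rectangle_const c (x₀ := 2 * f.1.1) (x₁ := 2 * f.top.1 + 1)
    (y₀ := 2 * f.1.2) (y₁ := 2 * f.top.2 + 1) (by omega) (by omega) w
    (fun x y h1 h2 h3 h4 h5 h6 => by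
      have e : PlaneEdge.top ((x, y), false) = (x + 1, y) := by simp [PlaneEdge.top, unitStep]
      have := hopen ((x, y), false) (by
        rw [mem_subEdges, e, hgrid, hgrid]; omega)
        (by rintro (h' | h')
            · exact h5 h'.symm
            · exact h6 (h'.trans e).symm)
      rwa [e] at this)
    (fun x y h1 h2 h3 h4 h5 h6 => by
      have e : PlaneEdge.top ((x, y), true) = (x, y + 1) := by simp [PlaneEdge.top, unitStep]
      have := hopen ((x, y), true) (by
        rw [mem_subEdges, e, hgrid, hgrid]; omega)
        (by rintro (h' | h')
            · exact h5 h'.symm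
            · exact h6 (h'.trans e).symm)
      rwa [e] at this)
  have key : ∀ b, b = f.1 ∨ b = f.top → MajorColour c b γ := by
    intro b hb
    refine ⟨w, fun a ha haw => ?_⟩
    have ha' : a ∈ grid f := mem_grid.2 (by rwa [ha])
    obtain ⟨x, y⟩ := a
    rw [hgrid] at ha'
    exact hγ x y ha'.1.1 ha'.1.2 ha'.2.1 ha'.2.2 haw
  rw [recolour_eq (key _ (Or.inl rfl)), recolour_eq (key _ (Or.inr rfl))]

lemma Compatible.iterate {O : PlaneEdge → Set Ω} {ω : Ω} {c : ℤ × ℤ → α}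
    (h : Compatible O ω c) (j : ℕ) : Compatible (Percolation.renorm^[j] O) ω (recolour^[j] c) := by
  induction j with
  | zero => exact h
  | succ j ih =>
    rw [Function.iterate_succ_apply', Function.iterate_succ_apply']
    exact ih.renorm

end Colour

variable {V : Type*} {G : SimpleGraph V} {μ : Measure (Config G)}

/-- The states of the coarse edges are determined by disjoint finite cells at their endpoints, and
each coarse edge is closed with probability at most `ε`. -/
structure IsCoarse (μ : Measure (Config G)) (O : PlaneEdge → Set (Config G))
    (R : ℤ × ℤ → Set V) (ε : ℝ) : Prop where
  finite : ∀ b, (R b).Finite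
  disjoint : Pairwise fun a b => Disjoint (R a) (R b)
  det : ∀ f, DeterminedBy (R f.1 ∪ R f.top) (O f)
  prob : ∀ f, μ.real (O f)ᶜ ≤ ε

/-- The union of the cells of a block. -/
def blockCell (R : ℤ × ℤ → Set V) (b : ℤ × ℤ) : Set V := ⋃ a ∈ {a | half a = b}, R a

lemma finite_half_eq (b : ℤ × ℤ) : {a | half a = b}.Finite := by
  refine (grid (b, false)).finite_toSet.subset fun a ha => ?_
  exact mem_grid.2 (Or.inl ha)

/-- A closed coarse edge yields two closed fine edges without common endpoint, which are
independent. There are at most `16² = 256` such pairs. -/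
lemma IsCoarse.renorm [IsProbabilityMeasure μ] (hμ : OneIndependent G μ)
    {O : PlaneEdge → Set (Config G)} {R : ℤ × ℤ → Set V} {ε : ℝ} (h : IsCoarse μ O R ε) :
    IsCoarse μ (renorm O) (blockCell R) (256 * ε ^ 2) where
  finite b := (finite_half_eq b).biUnion fun a _ => h.finite a
  disjoint a b hab := by
    simp only [blockCell, Set.disjoint_iUnion₂_right, Set.disjoint_iUnion₂_left]
    intro u hu v hv
    exact h.disjoint fun huv => hab (hv.symm.trans ((congrArg half huv).trans hu))
  det f := by
    have hsub : ∀ a ∈ grid f, R a ⊆ blockCell R f.1 ∪ blockCell R f.top := by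
      intro a ha
      rcases mem_grid.1 ha with ha | ha
      · exact (Set.subset_biUnion_of_mem (u := R) (s := {a | half a = f.1}) ha).trans
          Set.subset_union_left
      · exact (Set.subset_biUnion_of_mem (u := R) (s := {a | half a = f.top}) ha).trans
          Set.subset_union_right
    intro ω ω' hω hA g hg g' hg' hap
    have key : ∀ g ∈ subEdges f, ω ∈ O g → ω' ∈ O g := fun g hg =>
      ((h.det g).mono (Set.union_subset (hsub _ (mem_subEdges.1 hg).1)
        (hsub _ (mem_subEdges.1 hg).2))) ω ω' hω
    exact (hA g hg g' hg' hap).imp (key g hg) (key g' hg')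
  prob f := by
    classical
    set T := ((subEdges f) ×ˢ (subEdges f)).filter fun t => PlaneEdge.Apart t.1 t.2 with hT
    have hε : 0 ≤ ε := measureReal_nonneg.trans (h.prob f)
    have hsub : (Percolation.renorm O f)ᶜ ⊆ ⋃ t ∈ T, ((O t.1)ᶜ ∩ (O t.2)ᶜ) := by
      intro ω hω
      by_contra hcon
      refine hω fun g hg g' hg' hap => ?_
      by_contra! hno
      refine hcon (Set.mem_biUnion (x := (g, g')) ?_ ⟨hno.1, hno.2⟩)
      simp [hT, hg, hg', hap]
    refine (measureReal_mono hsub (measure_ne_top _ _)).trans ((measureReal_biUnion_finset_le _ _).trans ?_)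
    have hone : ∀ t ∈ T, μ.real ((O t.1)ᶜ ∩ (O t.2)ᶜ) ≤ ε ^ 2 := by
      intro t ht
      have hap : PlaneEdge.Apart t.1 t.2 := (Finset.mem_filter.1 ht).2
      have hne : ∀ u v, t.1.Touches u → t.2.Touches v → Disjoint (R u) (R v) :=
        fun u v hu hv => h.disjoint fun huv => hap u hu (huv ▸ hv)
      rw [hμ.measure_inter ((h.finite _).union (h.finite _)) ((h.finite _).union (h.finite _))
        ?_ (h.det t.1).compl (h.det t.2).compl, sq]
      · exact mul_le_mul (h.prob _) (h.prob _) measureReal_nonneg hε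
      · rw [Set.disjoint_union_left, Set.disjoint_union_right, Set.disjoint_union_right]
        exact ⟨⟨hne _ _ (Or.inl rfl) (Or.inl rfl), hne _ _ (Or.inl rfl) (Or.inr rfl)⟩,
          hne _ _ (Or.inr rfl) (Or.inl rfl), hne _ _ (Or.inr rfl) (Or.inr rfl)⟩
    refine (Finset.sum_le_sum hone).trans ?_
    rw [Finset.sum_const, nsmul_eq_mul]
    have hcard : T.card ≤ 256 := by
      refine (Finset.card_filter_le _ _).trans ?_
      rw [Finset.card_product]
      exact Nat.mul_le_mul (card_subEdges_le f) (card_subEdges_le f)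
    have : (T.card : ℝ) ≤ 256 := by exact_mod_cast hcard
    gcongr

/-- At `ε ≤ 1/512` one has `256 ε² ≤ ε / 2`, so each scale at least halves the bound. -/
lemma IsCoarse.iterate [IsProbabilityMeasure μ] (hμ : OneIndependent G μ)
    {O : PlaneEdge → Set (Config G)} {R : ℤ × ℤ → Set V}
    (h : IsCoarse μ O R (1 / 512)) (j : ℕ) :
    IsCoarse μ (Percolation.renorm^[j] O) (blockCell^[j] R) (1 / 512 * (1 / 2) ^ j) := by
  induction j with
  | zero => simpa using h
  | succ j ih =>
    rw [Function.iterate_succ_apply', Function.iterate_succ_apply']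
    have h' := ih.renorm hμ
    refine ⟨h'.finite, h'.disjoint, h'.det, fun f => (h'.prob f).trans ?_⟩
    have h1 : ((1 : ℝ) / 2) ^ j ≤ 1 := pow_le_one₀ (by norm_num) (by norm_num)
    have h2 : (0 : ℝ) < (1 / 2) ^ j := by positivity
    rw [pow_succ (1 / 2 : ℝ) j]
    nlinarith

lemma iterate_half_zero (j : ℕ) : half^[j] (0, 0) = (0, 0) := by
  induction j with
  | zero => rfl
  | succ j ih => rw [Function.iterate_succ_apply', ih]; rfl

/-- Halving sends `(1, 0)` to the fixed point `(0, 0)`, so an orbit visits `(1, 0)` at most once. -/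
lemma iterate_half_injective {x : ℤ × ℤ} {i j : ℕ} (hi : half^[i] x = (1, 0))
    (hj : half^[j] x = (1, 0)) : i = j := by
  have key : ∀ i j : ℕ, half^[i] x = (1, 0) → half^[j] x = (1, 0) → ¬ i < j := by
    intro i j hi hj hij
    obtain ⟨m, rfl⟩ : ∃ m, j = (m + 1) + i := ⟨j - i - 1, by omega⟩
    rw [Function.iterate_add_apply, hi, Function.iterate_succ_apply,
      show half (1, 0) = (0, 0) by rfl, iterate_half_zero] at hj
    simp at hj
  have h1 := key i j hi hj
  have h2 := key j i hj hi
  omega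

/-- A sufficiently reliable coarse edge model in which open coarse edges join components meeting
the cells at their endpoints percolates. -/
theorem IsCoarse.percolates [IsProbabilityMeasure μ] (hμ : OneIndependent G μ)
    {O : PlaneEdge → Set (Config G)} {R : ℤ × ℤ → Set V} (h : IsCoarse μ O R (1 / 512))
    (hcol : ∀ ω : Config G, ∃ c : ℤ × ℤ → (openGraph ω).ConnectedComponent,
      Compatible O ω c ∧ ∀ b, ∃ v ∈ R b, v ∈ (c b).supp) : Percolates μ := by
  -- These three edges connect the unit square at the origin, which is the block `(0, 0)` of the
  -- next scale.
  set S : Finset PlaneEdge := {((0, 0), false), ((0, 0), true), ((1, 0), true)} with hS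
  have hSc : S.card ≤ 3 := Finset.card_le_three
  set bad : Set (Config G) := ⋃ j : ℕ, ⋃ f ∈ S, (Percolation.renorm^[j] O f)ᶜ with hbad
  have hmeas : MeasurableSet bad := by
    refine MeasurableSet.iUnion fun j => Finset.measurableSet_biUnion _ fun f _ => ?_
    have hj := h.iterate hμ j
    exact ((hj.det f).measurableSet ((hj.finite _).union (hj.finite _))).compl
  have hlt : μ bad < 1 := by
    have h1 : ∀ j : ℕ, μ (⋃ f ∈ S, (Percolation.renorm^[j] O f)ᶜ) ≤
        ENNReal.ofReal (3 / 512 * (1 / 2) ^ j) := by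
      intro j
      rw [← ofReal_measureReal (measure_ne_top _ _)]
      refine ENNReal.ofReal_le_ofReal ?_
      refine (measureReal_biUnion_finset_le _ _).trans ?_
      refine (Finset.sum_le_sum fun f _ => (h.iterate hμ j).prob f).trans ?_
      rw [Finset.sum_const, nsmul_eq_mul]
      have : (S.card : ℝ) ≤ 3 := by exact_mod_cast hSc
      have h2 : (0 : ℝ) < (1 / 2) ^ j := by positivity
      nlinarith
    have hsum : HasSum (fun j : ℕ => (3 / 512 : ℝ) * (1 / 2) ^ j) (3 / 512 * 2) :=
      hasSum_geometric_two.mul_left _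
    calc μ bad ≤ ∑' j : ℕ, μ (⋃ f ∈ S, (Percolation.renorm^[j] O f)ᶜ) := measure_iUnion_le _
      _ ≤ ∑' j : ℕ, ENNReal.ofReal (3 / 512 * (1 / 2) ^ j) := ENNReal.tsum_le_tsum h1
      _ = ENNReal.ofReal (3 / 512 * 2) := by
        rw [← ENNReal.ofReal_tsum_of_nonneg (fun j => by positivity) hsum.summable, hsum.tsum_eq]
      _ < 1 := by
        rw [ENNReal.ofReal_lt_one]; norm_num
  have hpos : 0 < μ badᶜ := by
    rw [prob_compl_eq_one_sub hmeas]
    exact tsub_pos_of_lt hlt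
  refine hpos.trans_le (measure_mono fun ω hω => ?_)
  obtain ⟨c, hc, hcR⟩ := hcol ω
  have hopen : ∀ j : ℕ, ∀ f ∈ S, ω ∈ Percolation.renorm^[j] O f := by
    intro j f hf
    by_contra hno
    exact hω (Set.mem_iUnion.2 ⟨j, Set.mem_biUnion (x := f) hf hno⟩)
  have hstep : ∀ j : ℕ, recolour^[j] c (1, 0) = recolour^[j] c (0, 0) ∧
      recolour^[j] c (0, 1) = recolour^[j] c (0, 0) ∧
      recolour^[j] c (1, 1) = recolour^[j] c (0, 0) := by
    intro j
    have h1 := hc.iterate j _ (hopen j ((0, 0), false) (by simp [hS]))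
    have h2 := hc.iterate j _ (hopen j ((0, 0), true) (by simp [hS]))
    have h3 := hc.iterate j _ (hopen j ((1, 0), true) (by simp [hS]))
    simp only [PlaneEdge.top, unitStep, if_true, if_false, Bool.false_eq_true, Prod.mk_add_mk,
      add_zero, zero_add] at h1 h2 h3
    exact ⟨h1.symm, h2.symm, h3.symm.trans h1.symm⟩
  have hconst : ∀ j : ℕ, recolour^[j] c (0, 0) = c (0, 0) := by
    intro j
    induction j with
    | zero => rfl
    | succ j ih =>
      rw [Function.iterate_succ_apply']
      -- The exceptional point lies outside the block: all four points have the same colour.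
      refine recolour_eq ⟨(-1, -1), fun a ha _ => ?_⟩
      obtain ⟨h1, h2, h3⟩ := hstep j
      rw [← ih]
      obtain ⟨x, y⟩ := a
      simp only [half, Prod.mk.injEq] at ha
      have hx : x = 0 ∨ x = 1 := by omega
      have hy : y = 0 ∨ y = 1 := by omega
      rcases hx with rfl | rfl <;> rcases hy with rfl | rfl
      · rfl
      · exact h2
      · exact h1
      · exact h3
  refine ⟨c (0, 0), ?_⟩
  -- The point `x j` lies below `(1, 0)` at scale `j` and has the colour of the origin. These points
  -- are distinct, and their disjoint cells supply infinitely many vertices of one component.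
  choose x hx hcx using fun j : ℕ => exists_iterate_recolour_eq c j (1, 0)
  choose v hvR hvc using hcR
  refine Set.infinite_of_injective_forall_mem (f := fun j : ℕ => v (x j)) ?_ ?_
  · intro i j hij
    have hxx : x i = x j := by
      by_contra hne
      exact Set.disjoint_left.1 (h.disjoint hne) (hvR (x i)) (by
        have : v (x i) = v (x j) := hij
        rw [this]; exact hvR (x j))
    exact iterate_half_injective (hx i) (hxx ▸ hx j)
  · intro j
    have := hvc (x j)
    rwa [hcx j, (hstep j).1, hconst j] at this

end Renormalization

/-! ### Embedding plane, stars and cube into the lattice -/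

section Embedding

variable {k l M n : ℕ}

/-- The coordinates of the vertex `c` of the block at the site `s`. -/
def siteVec (s : Site l M) (c : Fin k → Bool) : Bool ⊕ Fin l ⊕ Fin M ⊕ Fin k → ℤ :=
  Sum.elim (fun b => if b then s.1.2 else s.1.1)
    (Sum.elim (fun i => if s.2.1 = some i then 1 else 0)
      (Sum.elim (fun r => if s.2.2 = some r then 1 else 0) fun a => if c a then 1 else 0))

lemma option_eq_of_indicator_eq {m : ℕ} {a b : Option (Fin m)}
    (h : ∀ i, (if a = some i then (1 : ℤ) else 0) = if b = some i then 1 else 0) : a = b := by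
  have key : ∀ i, a = some i ↔ b = some i := by
    intro i
    have := h i
    split_ifs at this <;> simp_all
  cases a with
  | some i => exact ((key i).1 rfl).symm
  | none =>
    cases b with
    | none => rfl
    | some i => exact (key i).2 rfl

/-- A star sits in the lattice with its centre at `0` and its leaves at unit vectors, so the
coordinates recover the site. -/
lemma siteVec_injective {s s' : Site l M} {c c' : Fin k → Bool}
    (h : siteVec s c = siteVec s' c') : s = s' ∧ c = c' := by
  obtain ⟨⟨x, y⟩, a, b⟩ := s
  obtain ⟨⟨x', y'⟩, a', b'⟩ := s'
  have h1 : x = x' := by simpa [siteVec] using congrFun h (Sum.inl false)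
  have h2 : y = y' := by simpa [siteVec] using congrFun h (Sum.inl true)
  have h3 : a = a' := option_eq_of_indicator_eq fun i => congrFun h (Sum.inr (Sum.inl i))
  have h4 : b = b' :=
    option_eq_of_indicator_eq fun i => congrFun h (Sum.inr (Sum.inr (Sum.inl i)))
  have h5 : c = c' := by
    funext i
    have := congrFun h (Sum.inr (Sum.inr (Sum.inr i)))
    simp only [siteVec, Sum.elim_inr] at this
    cases hc : c i <;> cases hc' : c' i <;> simp_all
  subst h1 h2 h3 h4 h5
  exact ⟨rfl, rfl⟩

/-- The block at the site `s` as a subcube of the lattice. -/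
noncomputable def siteBlock (j : Bool ⊕ Fin l ⊕ Fin M ⊕ Fin k ↪ Fin n) (s : Site l M) :
    cube k →g lattice n where
  toFun := fun c => Function.extend j (siteVec s c) 0
  map_rel' := by
    rintro c d ⟨a, ha, h⟩
    refine lattice_adj_extend j (Sum.inr (Sum.inr (Sum.inr a))) ?_ ?_
    · simp only [siteVec, Sum.elim_inr]
      cases hc : c a <;> cases hd : d a <;> simp_all
    · rintro (b | i | r | a') hne
      · rfl
      · rfl
      · rfl
      · have : c a' = d a' := by
          by_contra hcd
          exact hne (by rw [h a' hcd])
        simp [siteVec, this]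

variable (j : Bool ⊕ Fin l ⊕ Fin M ⊕ Fin k ↪ Fin n)

lemma siteBlock_injective (s : Site l M) : Function.Injective (siteBlock j s) := fun _ _ h =>
  (siteVec_injective (Function.extend_injective j.injective 0 h)).2

lemma siteBlock_disjoint :
    Pairwise fun u v => Disjoint (Set.range (siteBlock j u)) (Set.range (siteBlock j v)) := by
  intro u v huv
  refine Set.disjoint_left.2 ?_
  rintro _ ⟨c, rfl⟩ ⟨d, hd⟩
  exact huv (siteVec_injective (Function.extend_injective j.injective 0 hd)).1.symm

lemma siteBlock_adj_left (x : ℤ × ℤ) (i : Fin l) (b : Option (Fin M)) (c : Fin k → Bool) :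
    (lattice n).Adj (siteBlock j (x, some i, b) c) (siteBlock j (x, none, b) c) := by
  refine lattice_adj_extend j (Sum.inr (Sum.inl i)) (by simp [siteVec]) ?_
  rintro (b' | i' | r | a') hne
  · rfl
  · have : i ≠ i' := by rintro rfl; exact hne rfl
    simp [siteVec, this]
  · rfl
  · rfl

lemma siteBlock_adj_right (x : ℤ × ℤ) (a : Option (Fin l)) (r : Fin M) (c : Fin k → Bool) :
    (lattice n).Adj (siteBlock j (x, a, some r) c) (siteBlock j (x, a, none) c) := by
  refine lattice_adj_extend j (Sum.inr (Sum.inr (Sum.inl r))) (by simp [siteVec]) ?_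
  rintro (b' | i' | r' | a') hne
  · rfl
  · rfl
  · have : r ≠ r' := by rintro rfl; exact hne rfl
    simp [siteVec, this]
  · rfl

lemma siteBlock_adj_plane (f : PlaneEdge) (t : Option (Fin l) × Option (Fin M))
    (c : Fin k → Bool) :
    (lattice n).Adj (siteBlock j (f.1, t) c) (siteBlock j (f.top, t) c) := by
  obtain ⟨x, d⟩ := f
  refine lattice_adj_extend j (Sum.inl d) ?_ ?_
  · cases d <;> simp [siteVec, PlaneEdge.top, unitStep]
  · rintro (b' | i' | r' | a') hne
    · cases d <;> cases b' <;> simp_all [siteVec, PlaneEdge.top, unitStep]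
    · rfl
    · rfl
    · rfl

lemma siteBlock_adj_route (f : PlaneEdge) (i i' : Fin l) (r : Fin M)
    {e : Site l M × Site l M} (he : e ∈ routeEdges f.1 f.top i i' r) (c : Fin k → Bool) :
    (lattice n).Adj (siteBlock j e.1 c) (siteBlock j e.2 c) := by
  simp only [routeEdges, Finset.mem_insert, Finset.mem_singleton] at he
  rcases he with rfl | rfl | rfl | rfl | rfl
  · exact (siteBlock_adj_right j _ _ _ c).symm
  · exact siteBlock_adj_left j _ _ _ c
  · exact siteBlock_adj_plane j f _ c
  · exact (siteBlock_adj_left j _ _ _ c).symm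
  · exact siteBlock_adj_right j _ _ _ c

open Classical in
/-- The hubs give a colouring by components that is constant along open coarse edges. -/
lemma exists_hub_colouring {V : Type*} {G : SimpleGraph V} (β : Site l M → cube k →g G)
    (ω : Config G) : ∃ c : ℤ × ℤ → (openGraph ω).ConnectedComponent,
      Compatible (fun f : PlaneEdge => coarseOpen β f.1 f.top) ω c ∧
        ∀ b, ∃ v ∈ cell β b, v ∈ (c b).supp := by
  -- A point without a hub defaults to the central site. No open coarse edge touches it, so its
  -- colour only has to meet its cell.
  set h : ℤ × ℤ → Option (Fin l) := fun x =>
    if H : ∃ i, ω ∈ isHub β x i then some H.choose else none with hh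
  have hhub : ∀ x i, ω ∈ isHub β x i → h x = some i := by
    intro x i hi
    have H : ∃ i, ω ∈ isHub β x i := ⟨i, hi⟩
    simp only [hh, dif_pos H]
    rw [isHub_unique H.choose_spec hi]
  refine ⟨fun x => (openGraph ω).connectedComponentMk (β (x, h x, none) fun _ => false), ?_, ?_⟩
  · intro f hf
    obtain ⟨i, j, hi, hj, hr⟩ := coarseOpen.reachable hf
    beta_reduce
    rw [hhub _ i hi, hhub _ j hj]
    exact SimpleGraph.ConnectedComponent.sound (hr _ _)
  · intro b
    exact ⟨_, range_subset_cell (s := (b, h b, none)) rfl ⟨fun _ => false, rfl⟩, rfl⟩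

end Embedding

/-- If cubes of some dimension are connected with probability at least `P` and
`5 (1-p)^{2^k} ≤ P² / 2048`, then all models on lattices of large dimension percolate. -/
lemma exists_percolates {k : ℕ} {p P : ℝ} (hp₁ : p ≤ 1) (hP : 0 < P)
    (hratio : 10240 * (1 - p) ^ 2 ^ k ≤ P ^ 2)
    (hconn : ∀ μ ∈ DGe (cube k) p, P ≤ μ.real {ω | (openGraph ω).Connected}) :
    ∃ N : ℕ, ∀ n ≥ N, ∀ μ ∈ DGe (lattice n) p, Percolates μ := by
  -- The bound `P ≤ 1` is derived only from a model `μ`, whereas `l` and `M` must be fixed before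
  -- `n`; hence the case distinctions.
  obtain ⟨l, hl⟩ : ∃ l : ℕ, P ≤ 1 → (1 - P) ^ l < 1 / 8192 := by
    by_cases h : P ≤ 1
    · obtain ⟨l, hl⟩ := exists_pow_lt_of_lt_one (y := 1 - P)
        (by norm_num : (0 : ℝ) < 1 / 8192) (by linarith)
      exact ⟨l, fun _ => hl⟩
    · exact ⟨0, fun h' => absurd h' h⟩
  obtain ⟨M, hM⟩ : ∃ M : ℕ, (1 - P ^ 4) ^ M < 1 / 8192 / (l ^ 2 + 1) ∨ ¬ P ≤ 1 := by
    by_cases h : P ≤ 1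
    · obtain ⟨M, hM⟩ := exists_pow_lt_of_lt_one (y := 1 - P ^ 4)
        (by positivity : (0 : ℝ) < 1 / 8192 / (l ^ 2 + 1)) (by linarith [pow_pos hP 4])
      exact ⟨M, Or.inl hM⟩
    · exact ⟨0, Or.inr h⟩
  refine ⟨Fintype.card (Bool ⊕ Fin l ⊕ Fin M ⊕ Fin k), fun n hn μ hμ => ?_⟩
  have := hμ.1
  obtain ⟨j⟩ : Nonempty (Bool ⊕ Fin l ⊕ Fin M ⊕ Fin k ↪ Fin n) :=
    Function.Embedding.nonempty_of_card_le (by simpa using hn)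
  have hconn' : ∀ s : Site l M, P ≤ μ.real (blockConn (siteBlock j s)) := fun s =>
    le_measure_blockConn hconn hμ _ (siteBlock_injective j s)
  have hP₁ : P ≤ 1 := (hconn' (0, none, none)).trans measureReal_le_one
  have hl' := hl hP₁
  have hM' : l ^ 2 * (1 - P ^ 4) ^ M ≤ 1 / 8192 := by
    have h1 := hM.resolve_right (not_not.2 hP₁)
    rw [lt_div_iff₀ (by positivity)] at h1
    have h2 : 0 ≤ (1 - P ^ 4) ^ M := pow_nonneg (by linarith [pow_le_one₀ (n := 4) hP.le hP₁]) _
    nlinarith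
  have hr' : (1 - p) ^ 2 ^ k / P ^ 2 ≤ 1 / 10240 := by
    rw [div_le_iff₀ (by positivity)]
    linarith
  have hcoarse : IsCoarse μ (fun f : PlaneEdge => coarseOpen (siteBlock j) f.1 f.top)
      (cell (siteBlock j)) (1 / 512) :=
    { finite := cell_finite
      disjoint := fun _ _ h => cell_disjoint (siteBlock_disjoint j) h
      det := fun f => determinedBy_coarseOpen f.1 f.top
      prob := fun f => by
        have := measure_compl_coarseOpen_le hμ hp₁ (siteBlock_injective j)
          (siteBlock_disjoint j) hP hconn' (x := f.1) (y := f.top)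
          fun i i' r e he => siteBlock_adj_route j f i i' r he
        -- The budget is `2/8192 + 1/8192 + 5/10240 = 7/8192`, below `1/512`.
        linarith }
  exact hcoarse.percolates hμ.2.1 (exists_hub_colouring _)

end Percolation

theorem theorem1p4 (p : ℝ) (hp₀ : 0 < p) (hp₁ : p ≤ 1) (k : ℕ) (hk : 1 ≤ k) (P : ℝ)
    (hP : (1 - p) ^ (2 ^ (k - 1)) * Real.goldenRatio < P)
    (hconn : ∀ μ ∈ Percolation.DGe (Percolation.cube k) p,
      P ≤ μ.real {ω | (Percolation.openGraph ω).Connected}) :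
    (∃ N : ℕ, ∀ n ≥ N, ∀ μ ∈ Percolation.DGe (Percolation.lattice n) p,
      Percolation.Percolates μ) ∧
    ∃ L : ℝ, Tendsto (fun n : ℕ => Percolation.pMax (Percolation.lattice n)) atTop (𝓝 L) ∧
      L ≤ p := by
  obtain ⟨k', P', hP', hratio, hconn'⟩ :=
    Percolation.exists_conn_ratio hk hp₁ hP hconn 10240
  obtain ⟨N, hN⟩ := Percolation.exists_percolates hp₁ hP' hratio hconn'
  refine ⟨⟨N, hN⟩, _, tendsto_atTop_ciInf Percolation.pMax_lattice_antitone ?_, ?_⟩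
  · exact ⟨0, by rintro _ ⟨n, rfl⟩; exact Percolation.pMax_nonneg _⟩
  · exact (ciInf_le ⟨0, by rintro _ ⟨n, rfl⟩; exact Percolation.pMax_nonneg _⟩ N).trans
      (Percolation.pMax_le hp₀.le (hN N le_rfl))
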